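/- **Setting.** Consider a delay differential-algebraic equation (DDAE) $F(t,x,\dot x,\Delta_{-\tau}x)=0$ with $M$ scalar equations $F_1,\dots,F_M$ for $x=(x_1,\dots,x_n)$, where $(\Delta_{k\tau}x)(t)=x(t+k\tau)$, $\tau>0$. Let $\Theta$ be the set of those variables among $x_i,\dot x_i,\Delta_{-\tau}x_i$ that appear in (the expressions defining) $F$. Let $$R_{\mathrm{equal}}=\{(\theta,\tilde\theta)\in\Theta\times\Theta \mid \exists\,\xi\in\{x_1,\dots,x_n\},\ p,q\in\mathbb N_0,\ k,\ell\in\mathbb Z:\ \theta=\Delta_{k\tau}\xi^{(p)},\ \tilde\theta=\Delta_{\ell\tau}\xi^{(q)}\}.$$ The DDAE is *structurally nonsingular with respect to $\Theta/R_{\mathrm{equal}}$* if for every set $S$ of its equations $|S|\le|\Theta_S/R_{\mathrm{equal}}|$, where $\Theta_S\subseteq\Theta$ is the set of variables appearing in some equation of $S$. **The Pantelides algorithm for DDAEs** works on the bipartite graph in which an equation is joined to every variable $\Delta_{k\tau}\xi^{(p)}$ appearing in it. *Differentiating* an equation keeps its variables and adds the derivative $\Delta_{k\tau}\xi^{(p+1)}$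 of each of them; *shifting* it replaces each of its variables $\Delta_{k\tau}\xi^{(p)}$ by $\Delta_{(k+1)\tau}\xi^{(p)}$. The *shifting graph* is obtained by merging, for each $\xi$ and $k$, all $\Delta_{k\tau}\xi^{(p)}$, $p\ge0$, into one vertex $\xi_k$. The *differentiation graph* is obtained by dropping all variables with negative shift and merging, for each $\xi$ and $p$, all $\Delta_{k\tau}\xi^{(p)}$, $k\ge0$, into one vertex $\xi_p$. In both graphs, a vertex $\xi_k$ is *highest* if $k\ge0$ and no $\xi_{k+s}$ with $s>0$ is a vertex. *Main loop (for the shifting or for the differentiation graph).* Start with the empty matching. For the equations $r=1,2,\dots$ in turn repeat the following until a path is found: delete all variable vertices that are not highest, and search, by recursive depth-first search, for an augmenting path that starts in $r$. More precisely, the search from an equation $j$ colours $j$ and runs through the uncoloured neighbours $v$ of $j$; each such $v$ is coloured; if $v$ is unmatched a path has been found, otherwise the search is called recursively for the equation matched with $v$; as soon as a path has been found, $v$ is matched with $j$ and the search from $j$ ends successfully. If the search from $r$ is successful, proceed with the next $r$. If not, let $C$ be the set of coloured equations. In the differentiation graph, differentiate every equation of $C$ once. In the shifting graph, first differentiate every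 equation $j\in C$ exactly $\nu_j$ times, as described next, and then shift every equation of $C$ once. In both cases, for every coloured $\xi_k$ that is matched with an equation, match $\xi_{k+1}$ with that equation. *The numbers $\nu_j$.* A *connection* for $r$ is a connected set $P$ of alternating paths $(a,v,b)$ with $a,b\in C$, $\{v,b\}$ a matching edge and $\{a,v\}$ a non-matching edge of the reduced shifting graph, containing $r$ and all other equations of $C$, in which every matching edge $\{v,b\}$ with $b\in C$ occurs exactly once. For every connection $P$ let $\nu^P\in\mathbb N_0^C$ be the solution of the integer program: minimize $\sum_{j\in C}\nu_j$ subject to $\nu_a-\nu_b=d_b(v)-d_a(v)$ for all $(a,v,b)\in P$, where $d_j(\xi_k)$ is the largest $p$ such that $\Delta_{k\tau}\xi^{(p)}$ appears in equation $j$. Then $\nu_j=\max_P\nu^P_j$. *The algorithm.* Step 1 (shifting): run the main loop for the shifting graph. Step 2 (trimmed linearization): for each $i$ let $q_i$ be the largest order of a derivative of $x_i$ appearing with nonnegative shift. For each $i$ with $q_i\ge2$ replace, for $1\le p<q_i$ and all $k$, $\Delta_{k\tau}x_i^{(p)}$ by $\Delta_{k\tau}y_{i_p}$ with a new variable $y_{i_p}$,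 replace $\Delta_{k\tau}x_i^{(q_i)}$ by $\Delta_{k\tau}\dot y_{i_{q_i-1}}$, and append the equations $\Delta_{\ell_1\tau}\dot x_i=\Delta_{\ell_1\tau}y_{i_1}$ and $\Delta_{\ell_p\tau}\dot y_{i_{p-1}}=\Delta_{\ell_p\tau}y_{i_p}$ for $2\le p<q_i$, where $\ell_p$ is the largest $k$ such that (before the replacement) some $\Delta_{k\tau}x_i^{(q)}$ with $q\ge p$ appears. Step 3 (differentiation): run the main loop for the differentiation graph of the resulting system. **Theorem.** For every DDAE as above, and regardless of the (fixed) order in which the search runs through the neighbours of an equation, the Pantelides algorithm for DDAEs terminates if and only if the DDAE is structurally nonsingular with respect to $\Theta/R_{\mathrm{equal}}$. -/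

import Mathlib

namespace PantDDAE

/-! ### Variables, expressions and DDAEs -/

/-- The name `Δ_{kτ} ξ^{(p)}` of a variable: the `p`-th derivative (`der`) of the variable `ξ`
(`name`), evaluated at time `t + k τ` (`shift = k`). -/
structure DVar (X : Type) where
  name : X
  der : ℕ
  shift : ℤ
deriving DecidableEq

/-- The arguments, besides the time `t`, of `F(t, x, ẋ, x(t - τ))` for `x` with `n` components. -/
inductive Arg (n : ℕ) where
  | x (i : Fin n)
  | xdot (i : Fin n)
  | xdelay (i : Fin n)
deriving DecidableEq

/-- The variable name belonging to an argument of `F`. -/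
def Arg.toDVar {n : ℕ} : Arg n → DVar (Fin n)
  | .x i => ⟨i, 0, 0⟩
  | .xdot i => ⟨i, 1, 0⟩
  | .xdelay i => ⟨i, 0, -1⟩

/-- Real-valued expressions in the time `t` and in variables from `V`, built with arbitrary
real functions of finitely many arguments. That a variable appears in an equation is a property
of the expression (`x₁` appears in `sin² x₁ + cos² x₁`), not of the function it represents. -/
inductive SymExpr (V : Type) : Type where
  | time : SymExpr V
  | var (v : V) : SymExpr V
  | app {k : ℕ} (f : (Fin k → ℝ) → ℝ) (args : Fin k → SymExpr V) : SymExpr V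

/-- The value of an expression. -/
noncomputable def SymExpr.eval {V : Type} (t : ℝ) (val : V → ℝ) : SymExpr V → ℝ
  | .time => t
  | .var v => val v
  | .app f args => f fun a => (args a).eval t val

/-- The variables that appear in an expression. -/
def SymExpr.vars {V : Type} [DecidableEq V] : SymExpr V → Finset V
  | .time => ∅
  | .var v => {v}
  | .app _ args => Finset.univ.biUnion fun a => (args a).vars

/-- A DDAE `F(t, x, ẋ, x(t - τ)) = 0` with `M` scalar equations for `n` unknown functions. Its
`j`-th equation is `expr j = 0`. -/
structure DDAE (M n : ℕ) where
  expr : Fin M → SymExpr (Arg n)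

/-- The function `F` of the DDAE. -/
noncomputable def DDAE.F {M n : ℕ} (D : DDAE M n) (t : ℝ) (x xdot xdelay : Fin n → ℝ) :
    Fin M → ℝ :=
  fun j => (D.expr j).eval t fun
    | .x i => x i
    | .xdot i => xdot i
    | .xdelay i => xdelay i

/-- The variables that appear in the `j`-th equation. -/
def DDAE.vars {M n : ℕ} (D : DDAE M n) (j : Fin M) : Finset (DVar (Fin n)) :=
  (D.expr j).vars.image Arg.toDVar

/-- The set of variables `Θ` of the DDAE. -/
def DDAE.variables {M n : ℕ} (D : DDAE M n) : Set (DVar (Fin n)) :=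
  {v | ∃ j, v ∈ D.vars j}

/-! ### Structural nonsingularity -/

/-- The relation `R_equal`: two variables are related if they differ only in their order of
differentiation and in their shift. -/
def REqual (X : Type) : Setoid (DVar X) where
  r v w := ∃ (ξ : X) (p q : ℕ) (k l : ℤ), v = ⟨ξ, p, k⟩ ∧ w = ⟨ξ, q, l⟩
  iseqv :=
    { refl := fun v => ⟨v.name, v.der, v.der, v.shift, v.shift, rfl, rfl⟩
      symm := by
        rintro _ _ ⟨ξ, p, q, k, l, rfl, rfl⟩
        exact ⟨ξ, q, p, l, k, rfl, rfl⟩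
      trans := by
        rintro _ _ _ ⟨ξ, p, q, k, l, rfl, rfl⟩ ⟨ξ', p', q', k', l', h, rfl⟩
        obtain ⟨rfl, -, -⟩ := DVar.mk.inj h
        exact ⟨ξ, p, q', k, l', rfl, rfl⟩ }

/-- The subset `S` of the equations (`vars j` being the variables that appear in equation `j`) is
structurally singular with respect to the equivalence classes of `R`, restricted to those variables
of `Θ` that appear in `S`: it has more equations than there are equivalence classes. -/
def IsSingularSubset {Q V : Type} (vars : Q → Finset V) (Θ : Set V) (R : Setoid V)
    (S : Finset Q) : Prop :=
  Nat.card (Quotient (R.comap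
    (Subtype.val : {v : V // v ∈ Θ ∧ ∃ j ∈ S, v ∈ vars j} → V))) < S.card

/-- The equations are structurally nonsingular with respect to `Θ / R`. -/
def StructurallyNonsingular {Q V : Type} (vars : Q → Finset V) (Θ : Set V) (R : Setoid V) :
    Prop :=
  ¬ ∃ S : Finset Q, IsSingularSubset vars Θ R S

/-! ### Graphs of systems and their modification -/

/-- The graph of a system of (shifted and differentiated) equations. `eqs` lists the original
equations in the order of their numbering; the equation vertex belonging to `j` is currently
`Δ_{mτ} F_j^{(l)}` with `l = eqDer j`, `m = eqShift j`, and its edges lead to the variables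
in `vars j`. The variable vertices are the variables that appear in some equation. -/
structure SysGraph (Q X : Type) where
  eqs : List Q
  eqDer : Q → ℕ
  eqShift : Q → ℕ
  vars : Q → Finset (DVar X)

/-- The graph of a DDAE. -/
def DDAE.graph {M n : ℕ} (D : DDAE M n) : SysGraph (Fin M) (Fin n) where
  eqs := List.finRange M
  eqDer := fun _ => 0
  eqShift := fun _ => 0
  vars := D.vars

section

variable {Q X : Type} [DecidableEq Q] [DecidableEq X]

namespace SysGraph

/-- Differentiate equation `j` exactly `c j` times: by the chain rule the old variables are kept,
and their derivatives of order up to `c j` are added. -/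
def differentiate (G : SysGraph Q X) (c : Q → ℕ) : SysGraph Q X where
  eqs := G.eqs
  eqDer := fun j => G.eqDer j + c j
  eqShift := G.eqShift
  vars := fun j => (G.vars j).biUnion fun v =>
    (Finset.range (c j + 1)).image fun p => ⟨v.name, v.der + p, v.shift⟩

/-- Shift the equations in `C` once: all their variables are replaced by the shifted ones. -/
def shiftEqs (G : SysGraph Q X) (C : Finset Q) : SysGraph Q X where
  eqs := G.eqs
  eqDer := G.eqDer
  eqShift := fun j => if j ∈ C then G.eqShift j + 1 else G.eqShift j
  vars := fun j =>
    if j ∈ C then (G.vars j).image fun v => ⟨v.name, v.der, v.shift + 1⟩ else G.vars j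

end SysGraph

/-- The two types of graphs that the algorithm works with. -/
inductive StepType where
  | shift
  | dif

/-- The variable vertices adjacent to equation `j` in the shifting graph, respectively in the
differentiation graph. A vertex `x_{i,k}` is written `(i, k)`. In the shifting graph it stands for
all `Δ_{kτ} x_i^{(p)}` with arbitrary `p` and in the differentiation graph for all
`Δ_{lτ} x_i^{(k)}` with arbitrary `l ≥ 0`. -/
def tVars (ty : StepType) (G : SysGraph Q X) (j : Q) : Finset (X × ℤ) :=
  match ty with
  | .shift => (G.vars j).image fun v => (v.name, v.shift)
  | .dif => ((G.vars j).filter fun v => 0 ≤ v.shift).image fun v => (v.name, (v.der : ℤ))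

/-- `x_{i,k}` is a highest shift, respectively a highest derivative: it is a vertex with `k ≥ 0`,
and no `x_{i,k+s}` with `s > 0` is a vertex. -/
def IsHighest (ty : StepType) (G : SysGraph Q X) (v : X × ℤ) : Prop :=
  0 ≤ v.2 ∧ (∃ j ∈ G.eqs, v ∈ tVars ty G j) ∧
    ∀ s : ℤ, 0 < s → ¬ ∃ j ∈ G.eqs, (v.1, v.2 + s) ∈ tVars ty G j

open Classical in
/-- The neighbours of equation `j` after all vertices that are not highest shifts (respectively
highest derivatives) have been deleted. -/
noncomputable def nbrs (ty : StepType) (G : SysGraph Q X) (j : Q) : Finset (X × ℤ) :=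
  (tVars ty G j).filter fun v => IsHighest ty G v

/-! ### Augmenting paths -/

/-- An order in which a loop `for a ∈ s` runs through a finite set `s`. -/
structure Enumeration (α : Type) where
  toList : Finset α → List α
  spec : ∀ s : Finset α, (toList s : Multiset α) = s.val

/-- The data modified by the search for an augmenting path: the matching, and the sets of coloured
variable vertices and of coloured equations. -/
structure SearchState (Q X : Type) where
  assign : X × ℤ → Option Q
  colorV : Finset (X × ℤ)
  colorE : Finset Q

/-- `Search ord N j l s b s'`: in the bipartite graph in which equation `k` has the set of
neighbours `N k`, the loop of the recursive procedure `Augmentpath` with starting vertex `j`,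
of which the passes for the vertices in the list `l` are still to be made, terminates when started
in the state `s`; it returns `pathfound = b` and the state `s'`. -/
inductive Search (ord : Enumeration (X × ℤ)) (N : Q → Finset (X × ℤ)) :
    Q → List (X × ℤ) → SearchState Q X → Bool → SearchState Q X → Prop where
  /-- All neighbours have been considered: no path has been found. -/
  | done (j : Q) (s : SearchState Q X) : Search ord N j [] s false s
  /-- Coloured vertices are skipped. -/
  | skip (j : Q) (v : X × ℤ) (l : List (X × ℤ)) (s s' : SearchState Q X) (b : Bool) :
      v ∈ s.colorV → Search ord N j l s b s' → Search ord N j (v :: l) s b s'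
  /-- An exposed vertex is found: colour it and match it with `j`. -/
  | exposed (j : Q) (v : X × ℤ) (l : List (X × ℤ)) (s : SearchState Q X) :
      v ∉ s.colorV → s.assign v = none →
      Search ord N j (v :: l) s true
        ⟨Function.update s.assign v (some j), insert v s.colorV, s.colorE⟩
  /-- The vertex is matched with `k` and the recursive call for `k` finds a path. -/
  | found (j k : Q) (v : X × ℤ) (l : List (X × ℤ)) (s s₁ : SearchState Q X) :
      v ∉ s.colorV → s.assign v = some k →
      Search ord N k (ord.toList (N k))
        ⟨s.assign, insert v s.colorV, insert k s.colorE⟩ true s₁ →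
      Search ord N j (v :: l) s true
        ⟨Function.update s₁.assign v (some j), s₁.colorV, s₁.colorE⟩
  /-- The vertex is matched with `k` and the recursive call for `k` finds no path: go on. -/
  | failed (j k : Q) (v : X × ℤ) (l : List (X × ℤ)) (s s₁ s' : SearchState Q X) (b : Bool) :
      v ∉ s.colorV → s.assign v = some k →
      Search ord N k (ord.toList (N k))
        ⟨s.assign, insert v s.colorV, insert k s.colorE⟩ false s₁ →
      Search ord N j l s₁ b s' → Search ord N j (v :: l) s b s'

/-- The procedure `Augmentpath`, called for equation `j`, the matching `assign` and uncoloured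
vertices, terminates with `pathfound = b` in the state `s'`. -/
def Augmentpath (ord : Enumeration (X × ℤ)) (N : Q → Finset (X × ℤ)) (j : Q)
    (assign : X × ℤ → Option Q) (b : Bool) (s' : SearchState Q X) : Prop :=
  Search ord N j (ord.toList (N j)) ⟨assign, ∅, {j}⟩ b s'

/-! ### Differentiation during the shifting step -/

/-- A connection for the exposed equation `r`: a connected set of alternating paths `(a, v, b)`
between equations of `C`, with `{v, b}` in the matching and `{a, v}` a non-matching edge of the
shifting graph, such that each matching edge `{v, b}` with `b ∈ C` occurs exactly once. -/
def IsConnection (G : SysGraph Q X) (assign : X × ℤ → Option Q) (C : Finset Q) (r : Q)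
    (P : Finset (Q × (X × ℤ) × Q)) : Prop :=
  (∀ a v b, (a, v, b) ∈ P → a ∈ C ∧ b ∈ C ∧ v ∈ nbrs .shift G a ∧ v ∈ nbrs .shift G b ∧
    assign v = some b ∧ a ≠ b) ∧
  (∀ v b, b ∈ C → v ∈ nbrs .shift G b → assign v = some b → ∃! a, (a, v, b) ∈ P) ∧
  (∀ b ∈ C, Relation.EqvGen (fun a c => ∃ v, (a, v, c) ∈ P) r b)

/-- The highest order of differentiation with which a variable of the equivalence class `v` of the
shifting graph appears in equation `j`. -/
def topDer (G : SysGraph Q X) (j : Q) (v : X × ℤ) : ℕ :=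
  ((G.vars j).filter fun w => (w.name, w.shift) = v).sup DVar.der

/-- `ν` satisfies the constraints `ν_a - ν_b = topDer b v - topDer a v` of the integer program for
the connection `P`. -/
def IsFeasible (G : SysGraph Q X) (P : Finset (Q × (X × ℤ) × Q)) (ν : Q → ℕ) : Prop :=
  ∀ a v b, (a, v, b) ∈ P → (ν a : ℤ) - ν b = (topDer G b v : ℤ) - topDer G a v

/-- `ν` solves the integer program for the connection `P`, i.e. it is feasible and has the least
total number of differentiations of the equations in `C`. -/
def IsOptimal (G : SysGraph Q X) (C : Finset Q) (P : Finset (Q × (X × ℤ) × Q)) (ν : Q → ℕ) :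
    Prop :=
  IsFeasible G P ν ∧ ∀ ν' : Q → ℕ, IsFeasible G P ν' → ∑ j ∈ C, ν j ≤ ∑ j ∈ C, ν' j

/-- The number of differentiations of equation `j` before the equations in `C` are shifted: the
maximum over all connections of the solutions of the integer programs. -/
noncomputable def colorEdif (G : SysGraph Q X) (assign : X × ℤ → Option Q) (C : Finset Q) (r : Q)
    (j : Q) : ℕ :=
  if j ∈ C then
    sSup {m : ℕ | ∃ P ν, IsConnection G assign C r P ∧ IsOptimal G C P ν ∧ ν j = m}
  else 0

/-! ### The generalized Pantelides algorithm -/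

/-- The new graph after an unsuccessful search that started in `r` and coloured the equations in
`C`: the equations in `C` are differentiated in order to resolve implicit connections and are then
shifted once, respectively they are differentiated once. -/
noncomputable def updateGraph (ty : StepType) (G : SysGraph Q X) (assign : X × ℤ → Option Q)
    (C : Finset Q) (r : Q) : SysGraph Q X :=
  match ty with
  | .shift => (G.differentiate (colorEdif G assign C r)).shiftEqs C
  | .dif => G.differentiate fun j => if j ∈ C then 1 else 0

/-- The new matching after an unsuccessful search: if `x_{i,k}` is coloured and matched with an
equation, then `x_{i,k+1}` is matched with this equation. -/
def updateAssign (s : SearchState Q X) : X × ℤ → Option Q := fun v =>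
  if (v.1, v.2 - 1) ∈ s.colorV ∧ (s.assign (v.1, v.2 - 1)).isSome then
    s.assign (v.1, v.2 - 1)
  else s.assign v

/-- `RepeatLoop ord ty r c c'`: started with the graph and the matching `c`, the loop
`repeat … until pathfound` for the equation `r` terminates with `c'`. -/
inductive RepeatLoop (ord : Enumeration (X × ℤ)) (ty : StepType) (r : Q) :
    SysGraph Q X × (X × ℤ → Option Q) → SysGraph Q X × (X × ℤ → Option Q) → Prop where
  | found (G : SysGraph Q X) (assign : X × ℤ → Option Q) (s : SearchState Q X) :
      Augmentpath ord (nbrs ty G) r assign true s →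
      RepeatLoop ord ty r (G, assign) (G, s.assign)
  | again (G : SysGraph Q X) (assign : X × ℤ → Option Q) (s : SearchState Q X)
      (c' : SysGraph Q X × (X × ℤ → Option Q)) :
      Augmentpath ord (nbrs ty G) r assign false s →
      RepeatLoop ord ty r (updateGraph ty G assign s.colorE r, updateAssign s) c' →
      RepeatLoop ord ty r (G, assign) c'

/-- The loop over the equations in the given list terminates. -/
inductive ForLoop (ord : Enumeration (X × ℤ)) (ty : StepType) :
    List Q → SysGraph Q X × (X × ℤ → Option Q) → SysGraph Q X × (X × ℤ → Option Q) → Prop where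
  | nil (c : SysGraph Q X × (X × ℤ → Option Q)) : ForLoop ord ty [] c c
  | cons (r : Q) (l : List Q) (c c₁ c' : SysGraph Q X × (X × ℤ → Option Q)) :
      RepeatLoop ord ty r c c₁ → ForLoop ord ty l c₁ c' → ForLoop ord ty (r :: l) c c'

/-- The Pantelides algorithm, generalized to shifting and differentiation, terminates with output
`G'` when applied to `G`. -/
def Pantelides (ord : Enumeration (X × ℤ)) (ty : StepType) (G G' : SysGraph Q X) : Prop :=
  ∃ assign', ForLoop ord ty G.eqs (G, fun _ => none) (G', assign')

end

/-! ### Trimmed linearization -/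

/-- Names of variables after trimmed linearization: `inl i` is `x_i`, and `inr (i, p)` is the new
variable `y_{i_p}` for the `p`-th derivative of `x_i`. -/
abbrev TVar (n : ℕ) : Type := Fin n ⊕ (Fin n × ℕ)

/-- Names of equations after trimmed linearization: `inl j` is `F_j`, and `inr (i, p)` is the new
equation that couples `y_{i_p}` with the derivative of its predecessor. -/
abbrev TEq (M n : ℕ) : Type := Fin M ⊕ (Fin n × ℕ)

section

variable {M n : ℕ}

/-- The highest order `q_i` with which `x_i` is differentiated at a nonnegative shift. -/
def maxDer (G : SysGraph (Fin M) (Fin n)) (i : Fin n) : ℕ :=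
  G.eqs.toFinset.sup fun j =>
    ((G.vars j).filter fun v => v.name = i ∧ 0 ≤ v.shift).sup DVar.der

/-- The highest shift `ℓ_p` of a derivative of `x_i` of order at least `p`. -/
noncomputable def maxShift (G : SysGraph (Fin M) (Fin n)) (i : Fin n) (p : ℕ) : ℤ :=
  sSup {k : ℤ | ∃ j ∈ G.eqs, ∃ q, p ≤ q ∧ (⟨i, q, k⟩ : DVar (Fin n)) ∈ G.vars j}

/-- The variable by which a variable is replaced. -/
def trimVar (G : SysGraph (Fin M) (Fin n)) (v : DVar (Fin n)) : DVar (TVar n) :=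
  if 2 ≤ maxDer G v.name ∧ 1 ≤ v.der ∧ v.der < maxDer G v.name then
    ⟨.inr (v.name, v.der), 0, v.shift⟩
  else if 2 ≤ maxDer G v.name ∧ v.der = maxDer G v.name then
    ⟨.inr (v.name, v.der - 1), 1, v.shift⟩
  else ⟨.inl v.name, v.der, v.shift⟩

/-- Trimmed linearization: derivatives of order two and higher (at nonnegative shifts) are removed
by new variables `y_{i_p}`, `1 ≤ p < q_i`, and the equations `ẋ_i = y_{i_1}`, shifted `ℓ_1` times,
and `ẏ_{i_{p-1}} = y_{i_p}`, shifted `ℓ_p` times, are added. -/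
noncomputable def trim (G : SysGraph (Fin M) (Fin n)) : SysGraph (TEq M n) (TVar n) where
  eqs := G.eqs.map Sum.inl ++ (List.finRange n).flatMap fun i =>
    (List.range' 1 (maxDer G i - 1)).map fun p => Sum.inr (i, p)
  eqDer := Sum.elim G.eqDer fun _ => 0
  eqShift := Sum.elim G.eqShift fun ip => (maxShift G ip.1 ip.2).toNat
  vars := Sum.elim (fun j => (G.vars j).image (trimVar G)) fun ip =>
    {if ip.2 = 1 then ⟨.inl ip.1, 1, maxShift G ip.1 ip.2⟩
      else ⟨.inr (ip.1, ip.2 - 1), 1, maxShift G ip.1 ip.2⟩,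
     ⟨.inr ip, 0, maxShift G ip.1 ip.2⟩}

/-! ### The Pantelides algorithm for DDAEs -/

/-- The Pantelides algorithm for DDAEs (shifting step, trimmed linearization, differentiation step)
terminates when applied to the DDAE `D`; `ordS` and `ordD` are the orders in which the loops of
`Augmentpath` run through finite sets of vertices in the shifting and the differentiation step. -/
def DDAE.PantelidesTerminates (D : DDAE M n) (ordS : Enumeration (Fin n × ℤ))
    (ordD : Enumeration (TVar n × ℤ)) : Prop :=
  ∃ (G₁ : SysGraph (Fin M) (Fin n)) (G₂ : SysGraph (TEq M n) (TVar n)),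
    Pantelides ordS .shift D.graph G₁ ∧ Pantelides ordD .dif (trim G₁) G₂

end

end PantDDAE

set_option linter.unusedSectionVars false

namespace PantDDAE

/-! ### The search for an augmenting path -/

section

variable {Q X : Type} [DecidableEq Q] [DecidableEq X]

/-! A class of `R_equal` is determined by the name of the variable, so structural nonsingularity is
Hall's condition for the bipartite graph of equations and names: it says that the equations can be
assigned distinct names occurring in them (`DDAE.structurallyNonsingular_iff`). Neither shifting nor
differentiating changes which names occur in which equation.

Necessity: a terminated main loop matches all equations with distinct highest vertices. Each name
has at most one highest vertex, so the names are distinct as well (`Pantelides.exists_matching`).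
The shifting step alone yields this.

Sufficiency: suppose that all searches from `r` fail forever. Updates raise levels but preserve the
pairing of names with equations (`Advances.isMatched_iff`). Let `U` be the set of equations coloured
unboundedly often. The level of a name in an equation of `U` is unbounded, so the name gets coloured
and has a partner, and this partner must rise along with it; so it lies in `U`, and it is not the
unmatched `r`. Distinct names for the equations of `U` would therefore inject `U` into `U \ {r}`
(`InfiniteRun.false_of_injOn`). The numbers `ν_j` play no role, because the shifting graph merges
all derivatives.

It remains to carry distinct names over to the trimmed system, whose differentiation graph sees
nonnegative shifts only. The shifting step provides a matching at such shifts, and along each chain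
`x_i, y_{i_1}, …` the coupling equations can avoid the one position that an original equation
occupies (`exists_trim_matching`). -/

theorem Enumeration.mem_toList {α : Type} (ord : Enumeration α) (s : Finset α) (a : α) :
    a ∈ ord.toList s ↔ a ∈ s := by
  rw [← Multiset.mem_coe, ord.spec, Finset.mem_val]

/-- An unsuccessful search does not change the matching, and it colours a set of vertices and
equations that is closed under passing to neighbours and to partners in the matching. -/
structure SearchFails (N : Q → Finset (X × ℤ)) (l : List (X × ℤ)) (s s' : SearchState Q X) :
    Prop where
  assign_eq : s'.assign = s.assign
  colorV_mono : s.colorV ⊆ s'.colorV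
  colorE_mono : s.colorE ⊆ s'.colorE
  list_colored : ∀ v ∈ l, v ∈ s'.colorV
  partner_colored : ∀ v ∈ s'.colorV, v ∉ s.colorV → ∃ k ∈ s'.colorE, s.assign v = some k
  reached : ∀ v ∈ s'.colorV, v ∉ s.colorV → v ∈ l ∨ ∃ k ∈ s'.colorE, v ∈ N k
  nbrs_colored : ∀ k ∈ s'.colorE, k ∉ s.colorE → N k ⊆ s'.colorV
  partner : ∀ k ∈ s'.colorE, k ∉ s.colorE → ∃ v ∈ s'.colorV, s.assign v = some k

/-- Every recursive call inside a failing search fails too, so no step that writes to the matching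
is ever executed. -/
theorem Search.fails {ord : Enumeration (X × ℤ)} {N : Q → Finset (X × ℤ)} {j : Q}
    {l : List (X × ℤ)} {s s' : SearchState Q X} (h : Search ord N j l s false s') :
    SearchFails N l s s' := by
  generalize hb : false = b at h
  induction h with
  | done j s => constructor <;> simp_all
  | skip j v l s s' b hv _ ih =>
    have ih := ih hb
    exact ⟨ih.assign_eq, ih.colorV_mono, ih.colorE_mono,
      by
        intro w hw
        rcases List.mem_cons.1 hw with rfl | hw
        · exact ih.colorV_mono hv
        · exact ih.list_colored w hw,
      ih.partner_colored,
      fun w hw hw' => (ih.reached w hw hw').imp (List.mem_cons_of_mem _) id,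
      ih.nbrs_colored, ih.partner⟩
  | exposed => cases hb
  | found => cases hb
  | failed j k v l s s₁ s' b hv hk _ _ ih₁ ih₂ =>
    have i₁ := ih₁ rfl
    have i₂ := ih₂ hb
    have hv₁ : v ∈ s₁.colorV := i₁.colorV_mono (Finset.mem_insert_self _ _)
    have hk₁ : k ∈ s₁.colorE := i₁.colorE_mono (Finset.mem_insert_self _ _)
    have ha : s₁.assign = s.assign := i₁.assign_eq
    -- Whatever is newly coloured is `v` or `k`, or stems from the recursive call, or from the
    -- remaining passes; the four last fields split accordingly.
    refine ⟨i₂.assign_eq.trans ha, ?_, ?_, ?_, ?_, ?_, ?_, ?_⟩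
    · exact ((Finset.subset_insert _ _).trans i₁.colorV_mono).trans i₂.colorV_mono
    · exact ((Finset.subset_insert _ _).trans i₁.colorE_mono).trans i₂.colorE_mono
    · intro w hw
      rcases List.mem_cons.1 hw with rfl | hw
      · exact i₂.colorV_mono hv₁
      · exact i₂.list_colored w hw
    · intro w hw hws
      by_cases hw₁ : w ∈ s₁.colorV
      · by_cases hwv : w = v
        · exact ⟨k, i₂.colorE_mono hk₁, hwv ▸ hk⟩
        · obtain ⟨a, ha, h⟩ := i₁.partner_colored w hw₁ (by simp [hwv, hws])
          exact ⟨a, i₂.colorE_mono ha, h⟩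
      · obtain ⟨a, h₁, h₂⟩ := i₂.partner_colored w hw hw₁
        exact ⟨a, h₁, ha ▸ h₂⟩
    · intro w hw hws
      by_cases hw₁ : w ∈ s₁.colorV
      · by_cases hwv : w = v
        · exact .inl (by simp [hwv])
        · right
          rcases i₁.reached w hw₁ (by simp [hwv, hws]) with h | ⟨a, ha, h⟩
          · exact ⟨k, i₂.colorE_mono hk₁, (ord.mem_toList _ _).1 h⟩
          · exact ⟨a, i₂.colorE_mono ha, h⟩
      · exact (i₂.reached w hw hw₁).imp (List.mem_cons_of_mem _) id
    · intro a ha' has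
      by_cases ha₁ : a ∈ s₁.colorE
      · by_cases hak : a = k
        · subst hak
          exact fun w hw => i₂.colorV_mono (i₁.list_colored w ((ord.mem_toList _ _).2 hw))
        · exact (i₁.nbrs_colored a ha₁ (by simp [hak, has])).trans i₂.colorV_mono
      · exact i₂.nbrs_colored a ha' ha₁
    · intro a ha' has
      by_cases ha₁ : a ∈ s₁.colorE
      · by_cases hak : a = k
        · exact ⟨v, i₂.colorV_mono hv₁, hak ▸ hk⟩
        · obtain ⟨w, hw, h⟩ := i₁.partner a ha₁ (by simp [hak, has])
          exact ⟨w, i₂.colorV_mono hw, h⟩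
      · obtain ⟨w, h₁, h₂⟩ := i₂.partner a ha' ha₁
        exact ⟨w, h₁, ha ▸ h₂⟩

/-- Termination of the depth-first search: a recursive call colours a fresh vertex of `W` and so
lowers `d`, while continuing the loop keeps `d` and shortens the list. -/
theorem Search.exists_of_subset (ord : Enumeration (X × ℤ)) {N : Q → Finset (X × ℤ)}
    {W : Finset (X × ℤ)} (hN : ∀ j, N j ⊆ W) (d : ℕ) (l : List (X × ℤ)) :
    ∀ (j : Q) (s : SearchState Q X), (∀ v ∈ l, v ∈ W) → (W \ s.colorV).card ≤ d →
      ∃ b s', Search ord N j l s b s' := by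
  induction d generalizing l with
  | zero =>
    induction l with
    | nil => exact fun j s _ _ => ⟨_, _, .done j s⟩
    | cons v l ih =>
      intro j s hl hd
      obtain ⟨b, s', h⟩ := ih j s (fun w hw => hl w (List.mem_cons_of_mem _ hw)) hd
      have hv : v ∈ s.colorV := by
        have : W ⊆ s.colorV :=
          Finset.sdiff_eq_empty_iff_subset.1 (Finset.card_eq_zero.1 (Nat.le_zero.1 hd))
        exact this (hl v (by simp))
      exact ⟨b, s', .skip j v l s s' b hv h⟩
  | succ d ihd =>
    induction l with
    | nil => exact fun j s _ _ => ⟨_, _, .done j s⟩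
    | cons v l ih =>
      intro j s hl hd
      have hl' : ∀ w ∈ l, w ∈ W := fun w hw => hl w (List.mem_cons_of_mem _ hw)
      by_cases hv : v ∈ s.colorV
      · obtain ⟨b, s', h⟩ := ih j s hl' hd
        exact ⟨b, s', .skip j v l s s' b hv h⟩
      · cases hk : s.assign v with
        | none => exact ⟨_, _, .exposed j v l s hv hk⟩
        | some k =>
          have hlt : (W \ insert v s.colorV).card < (W \ s.colorV).card := by
            apply Finset.card_lt_card
            rw [Finset.ssubset_iff]
            refine ⟨v, by simp, ?_⟩
            intro w hw
            rcases Finset.mem_insert.1 hw with rfl | hw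
            · exact Finset.mem_sdiff.2 ⟨hl w (by simp), hv⟩
            · simp_all
          obtain ⟨b₁, s₁, h₁⟩ := ihd (ord.toList (N k)) k
            ⟨s.assign, insert v s.colorV, insert k s.colorE⟩
            (fun w hw => hN k ((ord.mem_toList _ _).1 hw)) (by dsimp only; omega)
          cases b₁ with
          | true => exact ⟨_, _, .found j k v l s s₁ hv hk h₁⟩
          | false =>
            have hs₁ : (W \ s₁.colorV).card ≤ (W \ insert v s.colorV).card :=
              Finset.card_le_card (Finset.sdiff_subset_sdiff le_rfl h₁.fails.colorV_mono)
            obtain ⟨b, s', h⟩ := ih j s₁ hl' (by omega)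
            exact ⟨b, s', .failed j k v l s s₁ s' b hv hk h₁ h⟩

/-- Both corrections are added rather than subtracted, to stay clear of truncated subtraction. -/
theorem card_filter_update (W : Finset (X × ℤ)) (f : X × ℤ → Option Q)
    {v : X × ℤ} (hv : v ∈ W) (j a : Q) :
    (W.filter fun w => Function.update f v (some j) w = some a).card +
        (if f v = some a then 1 else 0) =
      (W.filter fun w => f w = some a).card + if a = j then 1 else 0 := by
  rw [Finset.card_filter, Finset.card_filter, ← Finset.add_sum_erase W _ hv,
    ← Finset.add_sum_erase W (fun w => if f w = some a then 1 else 0) hv]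
  have : ∑ w ∈ W.erase v, (if Function.update f v (some j) w = some a then 1 else 0) =
      ∑ w ∈ W.erase v, if f w = some a then 1 else 0 :=
    Finset.sum_congr rfl fun w hw => by rw [Function.update_of_ne (Finset.ne_of_mem_erase hw)]
  rw [this]
  simp only [Function.update_self, Option.some.injEq, eq_comm (a := j)]
  omega

/-- A successful search that starts in `j` provides one more partner for `j`, and it does not change
the number of partners of any other equation. -/
structure SearchSucceeds (N : Q → Finset (X × ℤ)) (W : Finset (X × ℤ)) (j : Q)
    (s s' : SearchState Q X) : Prop where
  assign_colored : ∀ v ∈ s.colorV, s'.assign v = s.assign v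
  edge : ∀ v a, s'.assign v = some a → s.assign v = some a ∨ v ∈ N a
  card_eq : ∀ a, (W.filter fun w => s'.assign w = some a).card =
    (W.filter fun w => s.assign w = some a).card + if a = j then 1 else 0

/-- Along an augmenting path each intermediate equation gains one partner and hands one to its
predecessor; only the starting equation has a net gain. -/
theorem Search.succeeds {ord : Enumeration (X × ℤ)} {N : Q → Finset (X × ℤ)}
    {W : Finset (X × ℤ)} (hN : ∀ j, N j ⊆ W) {j : Q}
    {l : List (X × ℤ)} {s s' : SearchState Q X} (h : Search ord N j l s true s')
    (hl : ∀ v ∈ l, v ∈ N j) : SearchSucceeds N W j s s' := by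
  generalize hb : true = b at h
  induction h with
  | done => cases hb
  | skip j v l s s' b hv _ ih => exact ih (fun w hw => hl w (List.mem_cons_of_mem _ hw)) hb
  | exposed j v l s hv hs =>
    refine ⟨?_, ?_, ?_⟩
    · intro w hw
      exact Function.update_of_ne (by rintro rfl; exact hv hw) _ _
    · intro w a hw
      by_cases hwv : w = v
      · subst hwv
        simp only [Function.update_self, Option.some.injEq] at hw
        exact .inr (hw ▸ hl w (by simp))
      · left
        simpa [Function.update_of_ne hwv] using hw
    · intro a
      have := card_filter_update W s.assign (hN j (hl v (by simp))) j a
      simpa [hs] using this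
  | found j k v l s s₁ hv hk _ ih =>
    have i := ih (fun w hw => (ord.mem_toList _ _).1 hw) rfl
    -- As `v` is coloured before the recursive call, that call cannot reassign it, so `k` really
    -- loses `v`.
    have hv₁ : s₁.assign v = some k := (i.assign_colored v (Finset.mem_insert_self _ _)).trans hk
    refine ⟨?_, ?_, ?_⟩
    · intro w hw
      refine (Function.update_of_ne (by rintro rfl; exact hv hw) _ _).trans ?_
      exact i.assign_colored w (Finset.mem_insert_of_mem hw)
    · intro w a hw
      by_cases hwv : w = v
      · subst hwv
        simp only [Function.update_self, Option.some.injEq] at hw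
        exact .inr (hw ▸ hl w (by simp))
      · refine i.edge w a ?_
        simpa [Function.update_of_ne hwv] using hw
    · intro a
      have h₁ := card_filter_update W s₁.assign (hN j (hl v (by simp))) j a
      have h₂ := i.card_eq a
      simp only [hv₁, Option.some.injEq, eq_comm (a := k)] at h₁
      dsimp only at h₂ ⊢
      omega
  | failed j k v l s s₁ s' b hv hk h₁ _ _ ih₂ =>
    have i₂ := ih₂ (fun w hw => hl w (List.mem_cons_of_mem _ hw)) hb
    have i₁ := h₁.fails
    have ha : s₁.assign = s.assign := i₁.assign_eq
    exact ⟨fun w hw => (i₂.assign_colored w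
        (i₁.colorV_mono (Finset.mem_insert_of_mem hw))).trans (congrFun ha w),
      fun w a hw => ha ▸ i₂.edge w a hw, fun a => ha ▸ i₂.card_eq a⟩

end

/-! ### Highest vertices and the effect of an unsuccessful search -/

section

variable {Q X : Type} [DecidableEq Q] [DecidableEq X]

theorem IsHighest.le {ty : StepType} {G : SysGraph Q X} {i : X} {k m : ℤ}
    (h : IsHighest ty G (i, k)) {j : Q} (hj : j ∈ G.eqs) (hm : (i, m) ∈ tVars ty G j) :
    m ≤ k := by
  by_contra hlt
  exact h.2.2 (m - k) (by omega) ⟨j, hj, by simpa using hm⟩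

theorem IsHighest.unique {ty : StepType} {G : SysGraph Q X} {i : X} {k m : ℤ}
    (h : IsHighest ty G (i, k)) (h' : IsHighest ty G (i, m)) : k = m := by
  obtain ⟨j, hj, hv⟩ := h.2.1
  obtain ⟨j', hj', hv'⟩ := h'.2.1
  exact le_antisymm (h'.le hj hv) (h.le hj' hv')

theorem isHighest_of_le {ty : StepType} {G : SysGraph Q X} {i : X} {k : ℤ} (hk : 0 ≤ k) {j : Q}
    (hj : j ∈ G.eqs) (hv : (i, k) ∈ tVars ty G j)
    (h : ∀ a ∈ G.eqs, ∀ m, (i, m) ∈ tVars ty G a → m ≤ k) : IsHighest ty G (i, k) :=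
  ⟨hk, ⟨j, hj, hv⟩, fun s hs ⟨a, ha, hm⟩ => by have := h a ha _ hm; omega⟩

/-- The finite set of orders of the vertices that belong to `i`. -/
def levels (ty : StepType) (G : SysGraph Q X) (i : X) : Finset ℤ :=
  ((G.eqs.toFinset.biUnion (tVars ty G)).filter fun v => v.1 = i).image Prod.snd

theorem mem_levels {ty : StepType} {G : SysGraph Q X} {i : X} {k : ℤ} :
    k ∈ levels ty G i ↔ ∃ j ∈ G.eqs, (i, k) ∈ tVars ty G j := by
  simp [levels]

theorem exists_isHighest {ty : StepType} {G : SysGraph Q X} {i : X} {k : ℤ} (hk : 0 ≤ k) {j : Q}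
    (hj : j ∈ G.eqs) (hv : (i, k) ∈ tVars ty G j) : ∃ m, k ≤ m ∧ IsHighest ty G (i, m) := by
  have hne : k ∈ levels ty G i := mem_levels.2 ⟨j, hj, hv⟩
  obtain ⟨m, hm, hmax⟩ := (levels ty G i).exists_max_image id ⟨k, hne⟩
  obtain ⟨a, ha, hma⟩ := mem_levels.1 hm
  exact ⟨m, hmax k hne, isHighest_of_le (hk.trans (hmax k hne)) ha hma
    fun b hb p hp => hmax p (mem_levels.2 ⟨b, hb, hp⟩)⟩

theorem mem_nbrs {ty : StepType} {G : SysGraph Q X} {j : Q} {v : X × ℤ} :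
    v ∈ nbrs ty G j ↔ v ∈ tVars ty G j ∧ IsHighest ty G v := by
  classical
  simp [nbrs]

/-- `G'` is obtained from `G` by raising the vertices adjacent to the equations in `C` by one. -/
structure Advances (ty : StepType) (C : Finset Q) (G G' : SysGraph Q X) : Prop where
  eqs_eq : G'.eqs = G.eqs
  outside : ∀ j, j ∉ C → tVars ty G' j = tVars ty G j
  forward : ∀ j ∈ C, ∀ i k, (i, k) ∈ tVars ty G j → (i, k + 1) ∈ tVars ty G' j
  backward : ∀ j ∈ C, ∀ i k, (i, k) ∈ tVars ty G' j →
    (i, k) ∈ tVars ty G j ∨ (i, k - 1) ∈ tVars ty G j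

/-! ### Effect of an update on the vertices of the two graphs -/

theorem mem_tVars_shift {G : SysGraph Q X} {j : Q} {i : X} {k : ℤ} :
    (i, k) ∈ tVars .shift G j ↔ ∃ p, (⟨i, p, k⟩ : DVar X) ∈ G.vars j := by
  simp only [tVars, Finset.mem_image, Prod.mk.injEq]
  constructor
  · rintro ⟨⟨i', p, k'⟩, hv, rfl, rfl⟩
    exact ⟨p, hv⟩
  · rintro ⟨p, hp⟩
    exact ⟨_, hp, rfl, rfl⟩

theorem mem_tVars_dif {G : SysGraph Q X} {j : Q} {i : X} {k : ℤ} :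
    (i, k) ∈ tVars .dif G j ↔
      ∃ (p : ℕ) (l : ℤ), 0 ≤ l ∧ (p : ℤ) = k ∧ (⟨i, p, l⟩ : DVar X) ∈ G.vars j := by
  simp only [tVars, Finset.mem_image, Finset.mem_filter, Prod.mk.injEq]
  constructor
  · rintro ⟨⟨i', p, l⟩, ⟨hv, hl⟩, rfl, rfl⟩
    exact ⟨p, l, hl, rfl, hv⟩
  · rintro ⟨p, l, hl, rfl, hp⟩
    exact ⟨_, ⟨hp, hl⟩, rfl, rfl⟩

theorem SysGraph.mem_vars_differentiate {G : SysGraph Q X} {c : Q → ℕ} {j : Q} {i : X} {p : ℕ}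
    {k : ℤ} : (⟨i, p, k⟩ : DVar X) ∈ (G.differentiate c).vars j ↔
      ∃ q, q ≤ p ∧ p ≤ q + c j ∧ (⟨i, q, k⟩ : DVar X) ∈ G.vars j := by
  simp only [SysGraph.differentiate, Finset.mem_biUnion, Finset.mem_image, Finset.mem_range,
    DVar.mk.injEq]
  constructor
  · rintro ⟨⟨i', q, k'⟩, hv, e, he, rfl, rfl, rfl⟩
    exact ⟨q, Nat.le_add_right _ _, Nat.add_le_add_left (Nat.lt_succ_iff.1 he) _, hv⟩
  · rintro ⟨q, h₁, h₂, hv⟩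
    exact ⟨_, hv, p - q, by omega, rfl, by dsimp only; omega, rfl⟩

theorem tVars_shift_differentiate (G : SysGraph Q X) (c : Q → ℕ) (j : Q) :
    tVars .shift (G.differentiate c) j = tVars .shift G j := by
  ext ⟨i, k⟩
  rw [mem_tVars_shift, mem_tVars_shift]
  constructor
  · rintro ⟨p, hp⟩
    obtain ⟨q, -, -, hq⟩ := SysGraph.mem_vars_differentiate.1 hp
    exact ⟨q, hq⟩
  · rintro ⟨p, hp⟩
    exact ⟨p, SysGraph.mem_vars_differentiate.2 ⟨p, le_rfl, by omega, hp⟩⟩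

theorem tVars_shift_shiftEqs (G : SysGraph Q X) (C : Finset Q) (j : Q) :
    tVars .shift (G.shiftEqs C) j =
      if j ∈ C then (tVars .shift G j).image fun v => (v.1, v.2 + 1) else tVars .shift G j := by
  by_cases hj : j ∈ C <;>
    simp [tVars, SysGraph.shiftEqs, hj, Finset.image_image, Function.comp_def]

/-- `Advances` is the common abstraction of both update rules: shifting discards the old vertices,
differentiation keeps them, whence the alternative in `backward`. The differentiations before a
shift are invisible in the shifting graph, so nothing about `colorEdif` is needed. -/
theorem updateGraph_advances (ty : StepType) (G : SysGraph Q X) (assign : X × ℤ → Option Q)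
    (C : Finset Q) (r : Q) : Advances ty C G (updateGraph ty G assign C r) := by
  cases ty with
  | shift =>
    have key : ∀ j, tVars .shift (updateGraph .shift G assign C r) j =
        if j ∈ C then (tVars .shift G j).image (fun v => (v.1, v.2 + 1))
        else tVars .shift G j := by
      intro j
      rw [updateGraph, tVars_shift_shiftEqs, tVars_shift_differentiate]
    refine ⟨rfl, fun j hj => by rw [key, if_neg hj], fun j hj i k h => ?_, fun j hj i k h => ?_⟩
    · rw [key, if_pos hj]
      exact Finset.mem_image.2 ⟨_, h, rfl⟩
    · rw [key, if_pos hj] at h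
      obtain ⟨⟨i', k'⟩, hv, heq⟩ := Finset.mem_image.1 h
      simp only [Prod.mk.injEq] at heq
      obtain ⟨rfl, rfl⟩ := heq
      right
      simpa using hv
  | dif =>
    have key : ∀ j i k, (i, k) ∈ tVars .dif (updateGraph .dif G assign C r) j ↔
        (i, k) ∈ tVars .dif G j ∨ (j ∈ C ∧ (i, k - 1) ∈ tVars .dif G j) := by
      intro j i k
      rw [updateGraph, mem_tVars_dif, mem_tVars_dif, mem_tVars_dif]
      constructor
      · rintro ⟨p, l, hl, rfl, hv⟩
        obtain ⟨q, h₁, h₂, hq⟩ := SysGraph.mem_vars_differentiate.1 hv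
        by_cases hqp : q = p
        · exact .inl ⟨p, l, hl, rfl, hqp ▸ hq⟩
        · right
          by_cases hj : j ∈ C
          · simp only [hj, if_true] at h₂
            exact ⟨hj, q, l, hl, by omega, hq⟩
          · simp only [hj, if_false] at h₂
            omega
      · rintro (⟨p, l, hl, rfl, hv⟩ | ⟨hj, p, l, hl, hp, hv⟩)
        · exact ⟨p, l, hl, rfl, SysGraph.mem_vars_differentiate.2 ⟨p, le_rfl, by omega, hv⟩⟩
        · exact ⟨p + 1, l, hl, by push_cast; omega,
            SysGraph.mem_vars_differentiate.2 ⟨p, by omega, by simp [hj], hv⟩⟩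
    refine ⟨rfl, fun j hj => ?_, fun j hj i k h => ?_, fun j hj i k h => ?_⟩
    · ext ⟨i, k⟩
      simp [key, hj]
    · exact (key _ _ _).2 (.inr ⟨hj, by simpa using h⟩)
    · exact ((key _ _ _).1 h).imp id And.right

/-- The result of an unsuccessful search from `r`: a set of equations closed under passing to
neighbours and to partners, all of whose neighbours have partners in the set. -/
structure IsColored (ty : StepType) (G : SysGraph Q X) (r : Q) (s : SearchState Q X) : Prop where
  root_mem : r ∈ s.colorE
  nbrs_subset : ∀ j ∈ s.colorE, nbrs ty G j ⊆ s.colorV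
  partner_colored : ∀ v ∈ s.colorV, ∃ k ∈ s.colorE, s.assign v = some k
  reached : ∀ v ∈ s.colorV, ∃ k ∈ s.colorE, v ∈ nbrs ty G k
  partner : ∀ k ∈ s.colorE, k ≠ r → ∃ v ∈ s.colorV, s.assign v = some k

theorem Augmentpath.isColored {ord : Enumeration (X × ℤ)} {ty : StepType} {G : SysGraph Q X}
    {r : Q} {assign : X × ℤ → Option Q} {s : SearchState Q X}
    (h : Augmentpath ord (nbrs ty G) r assign false s) :
    s.assign = assign ∧ IsColored ty G r s := by
  have f := Search.fails h
  have ha : s.assign = assign := f.assign_eq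
  have hr : r ∈ s.colorE := f.colorE_mono (by simp)
  refine ⟨ha, hr, fun j hj => ?_, fun v hv => ?_, fun v hv => ?_, fun k hk hkr => ?_⟩
  · by_cases hjr : j = r
    · subst hjr
      exact fun v hv => f.list_colored v ((ord.mem_toList _ _).2 hv)
    · exact f.nbrs_colored j hj (by simpa using hjr)
  · exact ha ▸ f.partner_colored v hv (by simp)
  · rcases f.reached v hv (by simp) with h | h
    · exact ⟨r, hr, (ord.mem_toList _ _).1 h⟩
    · exact h
  · exact ha ▸ f.partner k hk (by simpa using hkr)

/-- The matching restricted to the highest vertices matches exactly the equations in `E`. -/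
structure IsMatching (ty : StepType) (G : SysGraph Q X) (assign : X × ℤ → Option Q)
    (E : Finset Q) : Prop where
  subset : ∀ j ∈ E, j ∈ G.eqs
  edge : ∀ v j, IsHighest ty G v → assign v = some j → j ∈ E ∧ v ∈ tVars ty G j
  unique : ∀ v w j, IsHighest ty G v → IsHighest ty G w → assign v = some j →
    assign w = some j → v = w
  total : ∀ j ∈ E, ∃ v, IsHighest ty G v ∧ assign v = some j
  bounded : ∀ v j, assign v = some j → 0 ≤ v.2 ∧ ∃ m, v.2 ≤ m ∧ ∃ a ∈ G.eqs, (v.1, m) ∈ tVars ty G a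

/-- The highest vertex that belongs to `i` is matched with `j`. -/
def IsMatched (ty : StepType) (G : SysGraph Q X) (assign : X × ℤ → Option Q) (i : X) (j : Q) :
    Prop :=
  ∃ k, IsHighest ty G (i, k) ∧ assign (i, k) = some j

theorem IsColored.isHighest {ty : StepType} {G : SysGraph Q X} {r : Q} {s : SearchState Q X}
    (hs : IsColored ty G r s) {v : X × ℤ} (hv : v ∈ s.colorV) : IsHighest ty G v := by
  obtain ⟨k, -, hk⟩ := hs.reached v hv
  exact (mem_nbrs.1 hk).2

theorem updateAssign_of_colored {s : SearchState Q X} {i : X} {k : ℤ} {j : Q}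
    (hv : (i, k) ∈ s.colorV) (hj : s.assign (i, k) = some j) :
    updateAssign s (i, k + 1) = some j := by
  simp [updateAssign, hv, hj]

/-! ### Transport of the matching through an unsuccessful search -/

section

variable {ty : StepType} {G G' : SysGraph Q X} {r : Q} {s : SearchState Q X} {E : Finset Q}

/-- The entry at `k` is overwritten only if `(i, k - 1)` is coloured; this vertex would then be
highest as well. -/
theorem updateAssign_of_not_colored (hs : IsColored ty G r s) {i : X} {k : ℤ}
    (hk : IsHighest ty G (i, k)) : updateAssign s (i, k) = s.assign (i, k) := by
  rw [updateAssign, if_neg]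
  rintro ⟨h, -⟩
  have := hk.unique (hs.isHighest h)
  omega

theorem IsColored.subset (hs : IsColored ty G r s) (hm : IsMatching ty G s.assign E) {j : Q}
    (hj : j ∈ s.colorE) : j = r ∨ j ∈ E := by
  by_cases h : j = r
  · exact .inl h
  · obtain ⟨v, hv, hvj⟩ := hs.partner j hj h
    exact .inr (hm.edge v j (hs.isHighest hv) hvj).1

theorem IsColored.mem_eqs (hs : IsColored ty G r s) (hm : IsMatching ty G s.assign E)
    (hr : r ∈ G.eqs) {j : Q} (hj : j ∈ s.colorE) : j ∈ G.eqs := by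
  rcases hs.subset hm hj with rfl | h
  exacts [hr, hm.subset j h]

theorem Advances.isHighest_of_colored (ha : Advances ty s.colorE G G') (hs : IsColored ty G r s)
    (hm : IsMatching ty G s.assign E) (hr : r ∈ G.eqs) {i : X} {k : ℤ} (hv : (i, k) ∈ s.colorV) :
    IsHighest ty G' (i, k + 1) := by
  obtain ⟨j, hj, hjv⟩ := hs.reached _ hv
  have hjv := mem_nbrs.1 hjv
  refine isHighest_of_le (by have := hjv.2.1; dsimp only at this; omega) (j := j) ?_
    (ha.forward j hj i k hjv.1) ?_
  · rw [ha.eqs_eq]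
    exact hs.mem_eqs hm hr hj
  · intro a haG m hma
    rw [ha.eqs_eq] at haG
    by_cases haC : a ∈ s.colorE
    · rcases ha.backward a haC i m hma with h | h <;> have := hjv.2.le haG h <;> omega
    · rw [ha.outside a haC] at hma
      have := hjv.2.le haG hma
      omega

/-- The coloured equations are closed under passing to neighbours, so none of them contains this
vertex. Those that move have `i` below level `k` and reach at most `k`. -/
theorem Advances.isHighest_of_not_colored (ha : Advances ty s.colorE G G')
    (hs : IsColored ty G r s) {i : X} {k : ℤ} (hk : IsHighest ty G (i, k))
    (hv : (i, k) ∉ s.colorV) :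
    IsHighest ty G' (i, k) := by
  have hC : ∀ a, (i, k) ∈ tVars ty G a → a ∉ s.colorE :=
    fun a h haC => hv (hs.nbrs_subset a haC (mem_nbrs.2 ⟨h, hk⟩))
  obtain ⟨j, hj, hjk⟩ := hk.2.1
  refine isHighest_of_le hk.1 (j := j) (by rwa [ha.eqs_eq])
    (by rwa [ha.outside j (hC j hjk)]) fun a haG m hma => ?_
  rw [ha.eqs_eq] at haG
  by_cases haC : a ∈ s.colorE
  · rcases ha.backward a haC i m hma with h | h
    · exact hk.le haG h
    · have h₁ := hk.le haG h
      by_contra hlt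
      have : m - 1 = k := by omega
      exact hC a (this ▸ h) haC
  · rw [ha.outside a haC] at hma
    exact hk.le haG hma

/-- The level `m` is `k + 1` or `k` according to the colour. A matching edge moves as a whole: the
partner of a coloured vertex is coloured, and no neighbour of an uncoloured highest vertex is. -/
theorem Advances.isMatched_of (ha : Advances ty s.colorE G G') (hs : IsColored ty G r s)
    (hm : IsMatching ty G s.assign E) (hr : r ∈ G.eqs) {i : X} {k : ℤ}
    (hk : IsHighest ty G (i, k)) : ∃ m, k ≤ m ∧ IsHighest ty G' (i, m) ∧
      updateAssign s (i, m) = s.assign (i, k) ∧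
      ∀ a, (i, k) ∈ tVars ty G a → s.assign (i, k) = some a → (i, m) ∈ tVars ty G' a := by
  by_cases hv : (i, k) ∈ s.colorV
  · obtain ⟨j, hj, hjv⟩ := hs.partner_colored _ hv
    refine ⟨k + 1, by omega, ha.isHighest_of_colored hs hm hr hv, ?_, ?_⟩
    · rw [hjv, updateAssign_of_colored hv hjv]
    · intro a hka haj
      obtain rfl : j = a := Option.some.inj (hjv.symm.trans haj)
      exact ha.forward j hj i k hka
  · refine ⟨k, le_rfl, ha.isHighest_of_not_colored hs hk hv, updateAssign_of_not_colored hs hk,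
      fun a hka _ => ?_⟩
    rw [ha.outside]
    · exact hka
    · exact fun haC => hv (hs.nbrs_subset a haC (mem_nbrs.2 ⟨hka, hk⟩))

/-- This is the purpose of the field `bounded`: a name that occurs only at negative levels has no
entries in the matching. -/
theorem IsMatching.assign_eq_none (hm : IsMatching ty G s.assign E) {i : X}
    (h : ∀ k, ¬ IsHighest ty G (i, k)) (k : ℤ) : s.assign (i, k) = none := by
  by_contra hne
  obtain ⟨a, hak⟩ := Option.ne_none_iff_exists'.1 hne
  obtain ⟨h0, m, hm', j, hj, hjm⟩ := hm.bounded _ _ hak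
  obtain ⟨p, -, hp⟩ := exists_isHighest (h0.trans hm') hj hjm
  exact h p hp

theorem Advances.isMatched_backward (ha : Advances ty s.colorE G G') (hs : IsColored ty G r s)
    (hm : IsMatching ty G s.assign E) (hr : r ∈ G.eqs) {i : X} {m : ℤ} {j : Q}
    (h : IsHighest ty G' (i, m)) (hj : updateAssign s (i, m) = some j) :
    ∃ k, IsHighest ty G (i, k) ∧ s.assign (i, k) = some j ∧ (i, m) ∈ tVars ty G' j := by
  by_cases hex : ∃ k, IsHighest ty G (i, k)
  · obtain ⟨k, hk⟩ := hex
    obtain ⟨m', -, hm', hass, hedge⟩ := ha.isMatched_of hs hm hr hk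
    obtain rfl := h.unique hm'
    rw [hj] at hass
    exact ⟨k, hk, hass.symm, hedge j (hm.edge _ _ hk hass.symm).2 hass.symm⟩
  -- The update may lift `i` from level `-1` to `0` and so create a highest vertex; it is unmatched.
  · push Not at hex
    simp only [updateAssign, hm.assign_eq_none hex] at hj
    simp at hj

theorem Advances.isMatched_iff (ha : Advances ty s.colorE G G') (hs : IsColored ty G r s)
    (hm : IsMatching ty G s.assign E) (hr : r ∈ G.eqs) {i : X} {j : Q} :
    IsMatched ty G' (updateAssign s) i j ↔ IsMatched ty G s.assign i j := by
  constructor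
  · rintro ⟨m, h, hj⟩
    obtain ⟨k, h₁, h₂, -⟩ := ha.isMatched_backward hs hm hr h hj
    exact ⟨k, h₁, h₂⟩
  · rintro ⟨k, h, hj⟩
    obtain ⟨m, -, h₁, h₂, -⟩ := ha.isMatched_of hs hm hr h
    exact ⟨m, h₁, h₂.trans hj⟩

theorem Advances.exists_ge (ha : Advances ty s.colorE G G') {i : X} {k : ℤ} {j : Q}
    (h : (i, k) ∈ tVars ty G j) : ∃ m, k ≤ m ∧ (i, m) ∈ tVars ty G' j := by
  by_cases hj : j ∈ s.colorE
  · exact ⟨k + 1, by omega, ha.forward j hj i k h⟩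
  · exact ⟨k, le_rfl, by rwa [ha.outside j hj]⟩

theorem Advances.isMatching (ha : Advances ty s.colorE G G') (hs : IsColored ty G r s)
    (hm : IsMatching ty G s.assign E) (hr : r ∈ G.eqs) :
    IsMatching ty G' (updateAssign s) E := by
  refine ⟨fun j hj => ha.eqs_eq ▸ hm.subset j hj, ?_, ?_, ?_, ?_⟩
  · rintro ⟨i, m⟩ j h hj
    obtain ⟨k, h₁, h₂, h₃⟩ := ha.isMatched_backward hs hm hr h hj
    exact ⟨(hm.edge _ _ h₁ h₂).1, h₃⟩
  · rintro ⟨i, m⟩ ⟨i', m'⟩ j h h' hj hj'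
    obtain ⟨k, h₁, h₂, -⟩ := ha.isMatched_backward hs hm hr h hj
    obtain ⟨k', h₁', h₂', -⟩ := ha.isMatched_backward hs hm hr h' hj'
    obtain ⟨rfl, rfl⟩ := Prod.mk.inj (hm.unique _ _ _ h₁ h₁' h₂ h₂')
    rw [h.unique h']
  · intro j hj
    obtain ⟨⟨i, k⟩, h₁, h₂⟩ := hm.total j hj
    obtain ⟨m, h₃, h₄⟩ := (ha.isMatched_iff hs hm hr).2 ⟨k, h₁, h₂⟩
    exact ⟨(i, m), h₃, h₄⟩
  · rintro ⟨i, k⟩ j h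
    by_cases hc : (i, k - 1) ∈ s.colorV
    · have h₁ := ha.isHighest_of_colored hs hm hr hc
      rw [sub_add_cancel] at h₁
      exact ⟨h₁.1, k, le_rfl, h₁.2.1⟩
    · rw [updateAssign, if_neg (by simp [hc])] at h
      obtain ⟨h0, m, hm', a, haG, ham⟩ := hm.bounded _ _ h
      obtain ⟨m', h₁, h₂⟩ := ha.exists_ge ham
      exact ⟨h0, m', hm'.trans h₁, a, ha.eqs_eq ▸ haG, h₂⟩

end

/-- The set of all highest vertices. -/
noncomputable def highestSet (ty : StepType) (G : SysGraph Q X) : Finset (X × ℤ) :=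
  G.eqs.toFinset.biUnion (nbrs ty G)

theorem mem_highestSet {ty : StepType} {G : SysGraph Q X} {v : X × ℤ} :
    v ∈ highestSet ty G ↔ IsHighest ty G v := by
  simp only [highestSet, Finset.mem_biUnion, List.mem_toFinset, mem_nbrs]
  constructor
  · rintro ⟨j, -, -, h⟩
    exact h
  · intro h
    obtain ⟨j, hj, hv⟩ := h.2.1
    exact ⟨j, hj, hv, h⟩

theorem nbrs_subset_highestSet {ty : StepType} {G : SysGraph Q X} (j : Q) :
    nbrs ty G j ⊆ highestSet ty G :=
  fun _ hv => mem_highestSet.2 (mem_nbrs.1 hv).2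

theorem exists_augmentpath (ord : Enumeration (X × ℤ)) (ty : StepType) (G : SysGraph Q X) (r : Q)
    (assign : X × ℤ → Option Q) : ∃ b s, Augmentpath ord (nbrs ty G) r assign b s :=
  Search.exists_of_subset ord nbrs_subset_highestSet _ _ r _
    (fun _ hv => nbrs_subset_highestSet r ((ord.mem_toList _ _).1 hv)) le_rfl

/-- All matching properties except edges and bounds are read off from the number of highest vertices
matched with each equation: one on `E`, zero elsewhere, and a success adds one at `r`. -/
theorem Augmentpath.isMatching {ord : Enumeration (X × ℤ)} {ty : StepType} {G : SysGraph Q X}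
    {r : Q} {assign : X × ℤ → Option Q} {s : SearchState Q X} {E : Finset Q}
    (h : Augmentpath ord (nbrs ty G) r assign true s) (hm : IsMatching ty G assign E)
    (hr : r ∈ G.eqs) (hrE : r ∉ E) : IsMatching ty G s.assign (insert r E) := by
  have f := Search.succeeds (nbrs_subset_highestSet (ty := ty) (G := G)) h
    fun v hv => (ord.mem_toList _ _).1 hv
  have hcard : ∀ a, ((highestSet ty G).filter fun w => s.assign w = some a).card =
      if a ∈ insert r E then 1 else 0 := by
    intro a
    rw [f.card_eq a]
    dsimp only
    have h₁ : ((highestSet ty G).filter fun w => assign w = some a).card =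
        if a ∈ E then 1 else 0 := by
      split_ifs with ha
      · obtain ⟨v, hv, hva⟩ := hm.total a ha
        rw [Finset.card_eq_one]
        refine ⟨v, ?_⟩
        ext w
        simp only [Finset.mem_filter, mem_highestSet, Finset.mem_singleton]
        exact ⟨fun hw => hm.unique w v a hw.1 hv hw.2 hva, fun hw => hw ▸ ⟨hv, hva⟩⟩
      · rw [Finset.card_eq_zero, Finset.filter_eq_empty_iff]
        exact fun w hw hwa => ha (hm.edge w a (mem_highestSet.1 hw) hwa).1
    rw [h₁]
    by_cases har : a = r
    · simp [har, hrE]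
    · simp [har]
  refine ⟨?_, fun v a hv hva => ⟨?_, ?_⟩, ?_, ?_, ?_⟩
  · intro j hj
    rcases Finset.mem_insert.1 hj with rfl | hj
    exacts [hr, hm.subset j hj]
  · by_contra ha
    have := hcard a
    rw [if_neg ha, Finset.card_eq_zero, Finset.filter_eq_empty_iff] at this
    exact this (mem_highestSet.2 hv) hva
  · rcases f.edge v a hva with h | h
    · exact (hm.edge v a hv h).2
    · exact (mem_nbrs.1 h).1
  · intro v w a hv hw hva hwa
    have : ((highestSet ty G).filter fun w => s.assign w = some a).card ≤ 1 := by
      rw [hcard]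
      split_ifs <;> omega
    exact Finset.card_le_one.1 this v (by simp [mem_highestSet, hv, hva]) w
      (by simp [mem_highestSet, hw, hwa])
  · intro j hj
    have := hcard j
    rw [if_pos hj] at this
    obtain ⟨v, hv⟩ := Finset.card_pos.1 (this.symm ▸ Nat.one_pos)
    rw [Finset.mem_filter, mem_highestSet] at hv
    exact ⟨v, hv⟩
  · intro v a hva
    rcases f.edge v a hva with h | h
    · exact hm.bounded v a h
    · have := (mem_nbrs.1 h).2
      exact ⟨this.1, v.2, le_rfl, this.2.1⟩

end

/-! ### Termination of the main loop -/

section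

variable {Q X : Type} [DecidableEq Q] [DecidableEq X]

/-- The variables that occur in the equations are the same up to their level. -/
def SameNames (ty : StepType) (G G' : SysGraph Q X) : Prop :=
  ∀ j i, (∃ k, (i, k) ∈ tVars ty G j) ↔ ∃ k, (i, k) ∈ tVars ty G' j

theorem Advances.sameNames {ty : StepType} {G G' : SysGraph Q X} {C : Finset Q}
    (ha : Advances ty C G G') : SameNames ty G G' := by
  intro j i
  by_cases hj : j ∈ C
  · constructor
    · rintro ⟨k, hk⟩
      exact ⟨k + 1, ha.forward j hj i k hk⟩
    · rintro ⟨k, hk⟩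
      rcases ha.backward j hj i k hk with h | h
      exacts [⟨k, h⟩, ⟨k - 1, h⟩]
  · rw [ha.outside j hj]

theorem SameNames.trans {ty : StepType} {G₁ G₂ G₃ : SysGraph Q X} (h : SameNames ty G₁ G₂)
    (h' : SameNames ty G₂ G₃) : SameNames ty G₁ G₃ :=
  fun j i => (h j i).trans (h' j i)

theorem RepeatLoop.spec {ord : Enumeration (X × ℤ)} {ty : StepType} {r : Q}
    {c c' : SysGraph Q X × (X × ℤ → Option Q)} (h : RepeatLoop ord ty r c c') {E : Finset Q}
    (hm : IsMatching ty c.1 c.2 E) (hr : r ∈ c.1.eqs) (hrE : r ∉ E) :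
    IsMatching ty c'.1 c'.2 (insert r E) ∧ c'.1.eqs = c.1.eqs ∧ SameNames ty c.1 c'.1 := by
  induction h with
  | found G assign s h => exact ⟨h.isMatching hm hr hrE, rfl, fun _ _ => Iff.rfl⟩
  | again G assign s c' h _ ih =>
    obtain ⟨hs, hc⟩ := h.isColored
    have ha := updateGraph_advances ty G assign s.colorE r
    obtain ⟨h₁, h₂, h₃⟩ := ih (ha.isMatching hc (hs ▸ hm) hr) (ha.eqs_eq ▸ hr)
    exact ⟨h₁, h₂.trans ha.eqs_eq, ha.sameNames.trans h₃⟩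

/-- The number of times that the equation `j` is coloured in the first `m` searches. -/
def colorCount (s : ℕ → SearchState Q X) (j : Q) (m : ℕ) : ℕ :=
  ((Finset.range m).filter fun t => j ∈ (s t).colorE).card

theorem colorCount_succ (s : ℕ → SearchState Q X) (j : Q) (m : ℕ) :
    colorCount s j (m + 1) = colorCount s j m + if j ∈ (s m).colorE then 1 else 0 := by
  unfold colorCount
  rw [Finset.range_add_one, Finset.filter_insert]
  split_ifs with h
  · rw [Finset.card_insert_of_notMem (by simp)]
  · rfl

/-- An infinite sequence of unsuccessful searches from `r`. -/
structure InfiniteRun (ty : StepType) (r : Q) (E : Finset Q) (f : ℕ → SysGraph Q X)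
    (s : ℕ → SearchState Q X) : Prop where
  colored : ∀ m, IsColored ty (f m) r (s m)
  advances : ∀ m, Advances ty (s m).colorE (f m) (f (m + 1))
  assign : ∀ m, (s (m + 1)).assign = updateAssign (s m)
  isMatching : ∀ m, IsMatching ty (f m) (s m).assign E
  root_mem : r ∈ (f 0).eqs
  root_notMem : r ∉ E

namespace InfiniteRun

variable {ty : StepType} {r : Q} {E : Finset Q} {f : ℕ → SysGraph Q X} {s : ℕ → SearchState Q X}

theorem eqs_eq (h : InfiniteRun ty r E f s) (m : ℕ) : (f m).eqs = (f 0).eqs := by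
  induction m with
  | zero => rfl
  | succ m ih => rw [(h.advances m).eqs_eq, ih]

theorem isMatched_iff (h : InfiniteRun ty r E f s) (m : ℕ) (i : X) (j : Q) :
    IsMatched ty (f m) (s m).assign i j ↔ IsMatched ty (f 0) (s 0).assign i j := by
  induction m with
  | zero => rfl
  | succ m ih =>
    rw [h.assign, (h.advances m).isMatched_iff (h.colored m) (h.isMatching m)
      (h.eqs_eq m ▸ h.root_mem), ih]

/-- With `le_of_mem`, this ties the level of a name in `j` to the number of colourings of `j`, up to
a constant. -/
theorem mem_forward (h : InfiniteRun ty r E f s) {i : X} {k : ℤ} {j : Q}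
    (hk : (i, k) ∈ tVars ty (f 0) j) (m : ℕ) :
    (i, k + colorCount s j m) ∈ tVars ty (f m) j := by
  induction m with
  | zero => simpa [colorCount] using hk
  | succ m ih =>
    rw [colorCount_succ]
    split_ifs with hj
    · have := (h.advances m).forward j hj _ _ ih
      push_cast
      rwa [← add_assoc]
    · rwa [add_zero, (h.advances m).outside j hj]

theorem le_of_mem (h : InfiniteRun ty r E f s) {i : X} {j : Q} {B : ℤ}
    (hB : ∀ k, (i, k) ∈ tVars ty (f 0) j → k ≤ B) (m : ℕ) :
    ∀ k, (i, k) ∈ tVars ty (f m) j → k ≤ B + colorCount s j m := by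
  induction m with
  | zero => simpa [colorCount] using hB
  | succ m ih =>
    intro k hk
    rw [colorCount_succ]
    split_ifs with hj
    · push_cast
      rcases (h.advances m).backward j hj _ _ hk with h | h <;> have := ih _ h <;> omega
    · rw [(h.advances m).outside j hj] at hk
      exact ih k hk

theorem exists_bound (G : SysGraph Q X) (i : X) : ∃ B : ℤ, 0 ≤ B ∧ ∀ j ∈ G.eqs, ∀ k,
    (i, k) ∈ tVars ty G j → k ≤ B := by
  obtain ⟨B, hB⟩ := (insert 0 (levels ty G i)).bddAbove
  exact ⟨B, hB (by simp), fun j hj k hk =>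
    hB (by simp only [Finset.coe_insert, Set.mem_insert_iff, Finset.mem_coe]
           exact .inr (mem_levels.2 ⟨j, hj, hk⟩))⟩

/-- If the vertices that belong to `i` are never coloured, then their level stays bounded. -/
theorem le_of_not_colored (h : InfiniteRun ty r E f s) {i : X} {B : ℤ} (hB0 : 0 ≤ B)
    (hB : ∀ j ∈ (f 0).eqs, ∀ k, (i, k) ∈ tVars ty (f 0) j → k ≤ B)
    (hi : ∀ m k, (i, k) ∉ (s m).colorV) (m : ℕ) :
    ∀ j ∈ (f 0).eqs, ∀ k, (i, k) ∈ tVars ty (f m) j → k ≤ B := by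
  induction m with
  | zero => exact hB
  | succ m ih =>
    intro j hj k hk
    by_cases hjC : j ∈ (s m).colorE
    · rcases (h.advances m).backward j hjC _ _ hk with hk' | hk'
      · exact ih j hj k hk'
      · have h₁ := ih j hj _ hk'
        -- Passing `B` means `k - 1 = B ≥ 0`, so `(i, k - 1)` is highest and adjacent to a coloured
        -- equation, hence coloured. Vertices at negative levels rise uncoloured, which is why `0 ≤
        -- B` is required.
        by_contra hlt
        refine hi m (k - 1) ((h.colored m).nbrs_subset j hjC (mem_nbrs.2 ⟨hk', ?_⟩))
        refine isHighest_of_le (by omega) (h.eqs_eq m ▸ hj) hk' fun a ha p hp => ?_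
        have := ih a (h.eqs_eq m ▸ ha) p hp
        omega
    · rw [(h.advances m).outside j hjC] at hk
      exact ih j hj k hk

/-- If `j` is coloured arbitrarily often and `i` occurs in `j`, then `i` is matched with an equation
that is coloured arbitrarily often. -/
theorem exists_partner (h : InfiniteRun ty r E f s) {j : Q} (hj : j ∈ (f 0).eqs)
    (hU : ∀ K, ∃ m, K ≤ colorCount s j m) {i : X} {k₀ : ℤ} (hi : (i, k₀) ∈ tVars ty (f 0) j) :
    ∃ a ∈ E, (∀ K, ∃ m, K ≤ colorCount s a m) ∧ IsMatched ty (f 0) (s 0).assign i a := by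
  obtain ⟨B, hB0, hB⟩ := exists_bound (ty := ty) (f 0) i
  have hcol : ∃ m k, (i, k) ∈ (s m).colorV := by
    by_contra! hcol
    obtain ⟨m, hm⟩ := hU ((B - k₀).toNat + 1)
    have := h.le_of_not_colored hB0 hB hcol m j hj _ (h.mem_forward hi m)
    omega
  obtain ⟨m, k, hk⟩ := hcol
  obtain ⟨a, -, haC⟩ := (h.colored m).partner_colored _ hk
  have hhigh := (h.colored m).isHighest hk
  have haE := ((h.isMatching m).edge _ _ hhigh haC).1
  have hmat := (h.isMatched_iff m i a).1 ⟨k, hhigh, haC⟩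
  refine ⟨a, haE, fun K => ?_, hmat⟩
  -- The highest level `p` of `i` is at least `k₀` plus the count of `j`, and at most `B` plus the
  -- count of its partner `a`; so `a` lags behind `j` by at most `B - k₀`.
  obtain ⟨m', hm'⟩ := hU (K + (B - k₀).toNat)
  obtain ⟨p, hp, hpa⟩ := (h.isMatched_iff m' i a).2 hmat
  have h₁ := hp.le (h.eqs_eq m' ▸ hj) (h.mem_forward hi m')
  have h₂ := h.le_of_mem (hB a ((h.isMatching 0).subset a haE)) m' p
    ((h.isMatching m').edge _ _ hp hpa).2
  exact ⟨m', by omega⟩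

/-- Pigeonhole on the set `U` of equations coloured unboundedly often: the partner of the name `π j`
lies in `U` but is not `r`, and different names have different partners. -/
theorem false_of_injOn (h : InfiniteRun ty r E f s) {π : Q → X}
    (hinj : ∀ a ∈ (f 0).eqs, ∀ b ∈ (f 0).eqs, π a = π b → a = b)
    (hπ : ∀ j ∈ (f 0).eqs, ∃ k, (π j, k) ∈ tVars ty (f 0) j) : False := by
  classical
  let U : Finset Q := (insert r E).filter fun j => ∀ K, ∃ m, K ≤ colorCount s j m
  have hmem : ∀ j ∈ U, j ∈ (f 0).eqs := by
    intro j hj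
    rcases Finset.mem_insert.1 (Finset.mem_filter.1 hj).1 with rfl | hj
    exacts [h.root_mem, (h.isMatching 0).subset j hj]
  have hrU : r ∈ U := by
    refine Finset.mem_filter.2 ⟨by simp, fun K => ⟨K, ?_⟩⟩
    have : ∀ t, r ∈ (s t).colorE := fun t => (h.colored t).root_mem
    simp [colorCount, this]
  have key : ∀ j : U, ∃ a ∈ U.erase r, IsMatched ty (f 0) (s 0).assign (π j) a := by
    rintro ⟨j, hj⟩
    obtain ⟨k, hk⟩ := hπ j (hmem j hj)
    obtain ⟨a, haE, haU, ha⟩ := h.exists_partner (hmem j hj) (Finset.mem_filter.1 hj).2 hk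
    exact ⟨a, Finset.mem_erase.2 ⟨fun har => h.root_notMem (har ▸ haE),
      Finset.mem_filter.2 ⟨Finset.mem_insert_of_mem haE, haU⟩⟩, ha⟩
  choose g hg hmat using key
  have hle : U.card ≤ (U.erase r).card := by
    rw [← Finset.card_attach]
    refine Finset.card_le_card_of_injOn g (fun j _ => hg j) ?_
    intro a _ b _ hab
    obtain ⟨k, h₁, h₂⟩ := hmat a
    obtain ⟨l, h₃, h₄⟩ := hmat b
    rw [← hab] at h₄
    exact Subtype.ext (hinj a (hmem a a.2) b (hmem b b.2)
      (Prod.mk.inj ((h.isMatching 0).unique _ _ _ h₁ h₃ h₂ h₄)).1)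
  have := Finset.card_erase_lt_of_mem hrU
  omega

end InfiniteRun

/-- The repeat loop terminates if the equations can be matched with different variables. -/
theorem exists_repeatLoop (ord : Enumeration (X × ℤ)) {ty : StepType} {r : Q}
    {c : SysGraph Q X × (X × ℤ → Option Q)} {E : Finset Q} (hm : IsMatching ty c.1 c.2 E)
    (hr : r ∈ c.1.eqs) (hrE : r ∉ E) {π : Q → X}
    (hinj : ∀ a ∈ c.1.eqs, ∀ b ∈ c.1.eqs, π a = π b → a = b)
    (hπ : ∀ j ∈ c.1.eqs, ∃ k, (π j, k) ∈ tVars ty c.1 j) : ∃ c', RepeatLoop ord ty r c c' := by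
  by_contra hno
  -- Where the loop cannot terminate, the search fails and the updated configuration cannot
  -- terminate either; choosing successors gives an infinite run.
  let P : SysGraph Q X × SearchState Q X → Prop := fun x =>
    IsMatching ty x.1 x.2.assign E ∧ r ∈ x.1.eqs ∧ IsColored ty x.1 r x.2 ∧
      ¬ ∃ c', RepeatLoop ord ty r (x.1, x.2.assign) c'
  have start : ∀ (G : SysGraph Q X) (assign : X × ℤ → Option Q), IsMatching ty G assign E →
      r ∈ G.eqs → (¬ ∃ c', RepeatLoop ord ty r (G, assign) c') →
      ∃ s, s.assign = assign ∧ P (G, s) ∧ Augmentpath ord (nbrs ty G) r assign false s := by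
    intro G assign hm hr hno
    obtain ⟨b, s, hs⟩ := exists_augmentpath ord ty G r assign
    cases b with
    | true => exact absurd ⟨_, .found G assign s hs⟩ hno
    | false =>
      obtain ⟨h₁, h₂⟩ := hs.isColored
      exact ⟨s, h₁, ⟨h₁ ▸ hm, hr, h₂, h₁ ▸ hno⟩, hs⟩
  have step : ∀ x : {x // P x ∧ Augmentpath ord (nbrs ty x.1) r x.2.assign false x.2},
      ∃ y : {x // P x ∧ Augmentpath ord (nbrs ty x.1) r x.2.assign false x.2},
      y.1.1 = updateGraph ty x.1.1 x.1.2.assign x.1.2.colorE r ∧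
      y.1.2.assign = updateAssign x.1.2 := by
    rintro ⟨⟨G, s⟩, ⟨hm, hr, hc, hno⟩, hs⟩
    have ha := updateGraph_advances ty G s.assign s.colorE r
    obtain ⟨s', h₁, h₂, h₃⟩ := start (updateGraph ty G s.assign s.colorE r) (updateAssign s)
      (ha.isMatching hc hm hr) (ha.eqs_eq ▸ hr)
      (fun ⟨c', hc'⟩ => hno ⟨c', .again G s.assign s c' hs hc'⟩)
    exact ⟨⟨(_, s'), h₂, h₁ ▸ h₃⟩, rfl, h₁⟩
  choose next hnext₁ hnext₂ using step
  obtain ⟨s₀, h₁, h₂, h₃⟩ := start c.1 c.2 hm hr hno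
  let run : ℕ → {x // P x ∧ Augmentpath ord (nbrs ty x.1) r x.2.assign false x.2} :=
    fun m => Nat.rec ⟨(c.1, s₀), h₂, h₁ ▸ h₃⟩ (fun _ x => next x) m
  have hrun : InfiniteRun ty r E (fun m => (run m).1.1) (fun m => (run m).1.2) :=
    { colored := fun m => (run m).2.1.2.2.1
      advances := fun m => by
        have := updateGraph_advances ty (run m).1.1 (run m).1.2.assign (run m).1.2.colorE r
        rw [← hnext₁] at this
        exact this
      assign := fun m => hnext₂ _
      isMatching := fun m => (run m).2.1.1
      root_mem := hr
      root_notMem := hrE }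
  exact hrun.false_of_injOn hinj hπ

theorem ForLoop.spec {ord : Enumeration (X × ℤ)} {ty : StepType} {l : List Q}
    {c c' : SysGraph Q X × (X × ℤ → Option Q)} (h : ForLoop ord ty l c c') :
    ∀ {E : Finset Q}, IsMatching ty c.1 c.2 E → (∀ r ∈ l, r ∈ c.1.eqs) → (∀ r ∈ l, r ∉ E) →
      l.Nodup → IsMatching ty c'.1 c'.2 (E ∪ l.toFinset) ∧ c'.1.eqs = c.1.eqs ∧
        SameNames ty c.1 c'.1 := by
  induction h with
  | nil c =>
    intro E hm _ _ _
    exact ⟨by simpa using hm, rfl, fun _ _ => Iff.rfl⟩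
  | cons r l c c₁ c' h _ ih =>
    intro E hm hl hE hnd
    obtain ⟨h₁, h₂, h₃⟩ := h.spec hm (hl r (by simp)) (hE r (by simp))
    rw [List.nodup_cons] at hnd
    obtain ⟨i₁, i₂, i₃⟩ := ih h₁ (fun a ha => h₂ ▸ hl a (by simp [ha]))
      (fun a ha => by
        simp only [Finset.mem_insert, not_or]
        exact ⟨fun har => hnd.1 (har ▸ ha), hE a (by simp [ha])⟩) hnd.2
    refine ⟨?_, i₂.trans h₂, h₃.trans i₃⟩
    rw [List.toFinset_cons, Finset.union_insert, ← Finset.insert_union]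
    exact i₁

theorem exists_forLoop (ord : Enumeration (X × ℤ)) {ty : StepType} (l : List Q) :
    ∀ {c : SysGraph Q X × (X × ℤ → Option Q)} {E : Finset Q} {π : Q → X},
      IsMatching ty c.1 c.2 E → (∀ r ∈ l, r ∈ c.1.eqs) → (∀ r ∈ l, r ∉ E) → l.Nodup →
      (∀ a ∈ c.1.eqs, ∀ b ∈ c.1.eqs, π a = π b → a = b) →
      (∀ j ∈ c.1.eqs, ∃ k, (π j, k) ∈ tVars ty c.1 j) → ∃ c', ForLoop ord ty l c c' := by
  induction l with
  | nil => exact fun _ _ _ _ _ _ => ⟨_, .nil _⟩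
  | cons r l ih =>
    intro c E π hm hl hE hnd hinj hπ
    obtain ⟨c₁, h⟩ := exists_repeatLoop ord hm (hl r (by simp)) (hE r (by simp)) hinj hπ
    obtain ⟨h₁, h₂, h₃⟩ := h.spec hm (hl r (by simp)) (hE r (by simp))
    rw [List.nodup_cons] at hnd
    obtain ⟨c', h'⟩ := ih (π := π) h₁ (fun a ha => h₂ ▸ hl a (by simp [ha]))
      (fun a ha => by
        simp only [Finset.mem_insert, not_or]
        exact ⟨fun har => hnd.1 (har ▸ ha), hE a (by simp [ha])⟩) hnd.2
      (h₂ ▸ hinj) (fun j hj => (h₃ j (π j)).1 (hπ j (h₂ ▸ hj)))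
    exact ⟨c', .cons r l c c₁ c' h h'⟩

theorem isMatching_none (ty : StepType) (G : SysGraph Q X) :
    IsMatching ty G (fun _ => none) ∅ := by
  constructor <;> simp

theorem exists_pantelides (ord : Enumeration (X × ℤ)) {ty : StepType} {G : SysGraph Q X}
    (hnd : G.eqs.Nodup) {π : Q → X} (hinj : ∀ a ∈ G.eqs, ∀ b ∈ G.eqs, π a = π b → a = b)
    (hπ : ∀ j ∈ G.eqs, ∃ k, (π j, k) ∈ tVars ty G j) : ∃ G', Pantelides ord ty G G' := by
  obtain ⟨c', h⟩ := exists_forLoop (c := (G, fun _ => none)) ord G.eqs (isMatching_none ty G)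
    (fun _ h => h) (by simp) hnd hinj hπ
  exact ⟨c'.1, c'.2, h⟩

/-- When the algorithm has terminated, the equations are matched with different variables. -/
theorem Pantelides.exists_matching {ord : Enumeration (X × ℤ)} {ty : StepType}
    {G G' : SysGraph Q X} (h : Pantelides ord ty G G') (hnd : G.eqs.Nodup) :
    G'.eqs = G.eqs ∧ SameNames ty G G' ∧
      ∃ v : {j // j ∈ G.eqs} → X × ℤ, (∀ j, 0 ≤ (v j).2 ∧ v j ∈ tVars ty G' j) ∧
        Function.Injective fun j => (v j).1 := by
  obtain ⟨assign, h⟩ := h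
  obtain ⟨h₁, h₂, h₃⟩ := h.spec (isMatching_none ty G) (fun _ h => h) (by simp) hnd
  rw [Finset.empty_union] at h₁
  refine ⟨h₂, h₃, ?_⟩
  choose v hv hass using fun j : {j // j ∈ G.eqs} => h₁.total j (List.mem_toFinset.2 j.2)
  refine ⟨v, fun j => ⟨(hv j).1, (h₁.edge _ _ (hv j) (hass j)).2⟩, fun a b hab => ?_⟩
  -- Equal names force equal vertices, since a name has only one highest vertex.
  have h₄ : IsHighest ty G' ((v a).1, (v a).2) := hv a
  have h₅ : IsHighest ty G' ((v a).1, (v b).2) := by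
    rw [show (v a).1 = (v b).1 from hab]
    exact hv b
  have hvv : v a = v b := Prod.ext hab (h₄.unique h₅)
  have ha := hass a
  rw [hvv, hass b] at ha
  exact Subtype.ext (Option.some.inj ha).symm

end

/-! ### Structural nonsingularity and Hall's condition -/

section

variable {M n : ℕ}

theorem DDAE.mem_tVars_graph {D : DDAE M n} {j : Fin M} {i : Fin n} :
    (∃ k, (i, k) ∈ tVars .shift D.graph j) ↔ i ∈ (D.vars j).image DVar.name := by
  simp only [mem_tVars_shift, Finset.mem_image]
  constructor
  · rintro ⟨k, p, h⟩
    exact ⟨_, h, rfl⟩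
  · rintro ⟨⟨i', p, k⟩, h, rfl⟩
    exact ⟨k, p, h⟩

/-- The class of a variable is determined by its name, so that the number of classes is the number
of names. -/
theorem DDAE.card_quotient (D : DDAE M n) (S : Finset (Fin M)) :
    Nat.card (Quotient ((REqual (Fin n)).comap
      (Subtype.val : {v // v ∈ D.variables ∧ ∃ j ∈ S, v ∈ D.vars j} → DVar (Fin n)))) =
      (S.biUnion fun j => (D.vars j).image DVar.name).card := by
  rw [← Fintype.card_coe, ← Nat.card_eq_fintype_card]
  refine Nat.card_eq_of_bijective (Quotient.lift (fun v => ⟨v.1.name, ?_⟩) ?_) ⟨?_, ?_⟩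
  · obtain ⟨j, hj, hv⟩ := v.2.2
    exact Finset.mem_biUnion.2 ⟨j, hj, Finset.mem_image_of_mem _ hv⟩
  · rintro ⟨v, hv⟩ ⟨w, hw⟩ ⟨ξ, p, q, k, l, h, h'⟩
    dsimp only at h h'
    subst h h'
    rfl
  · rintro ⟨v, hv⟩ ⟨w, hw⟩ h
    exact Quotient.sound ⟨v.name, v.der, w.der, v.shift, w.shift, rfl,
      congrArg (DVar.mk · w.der w.shift) (congrArg Subtype.val h).symm⟩
  · rintro ⟨i, hi⟩
    obtain ⟨j, hj, hi⟩ := Finset.mem_biUnion.1 hi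
    obtain ⟨v, hv, rfl⟩ := Finset.mem_image.1 hi
    exact ⟨Quotient.mk _ ⟨v, ⟨j, hv⟩, j, hj, hv⟩, rfl⟩

/-- Once classes are counted by names, this is Hall's marriage theorem. -/
theorem DDAE.structurallyNonsingular_iff (D : DDAE M n) :
    StructurallyNonsingular D.vars D.variables (REqual (Fin n)) ↔
      ∃ π : Fin M → Fin n, Function.Injective π ∧ ∀ j, π j ∈ (D.vars j).image DVar.name := by
  rw [← Finset.all_card_le_biUnion_card_iff_exists_injective]
  simp only [StructurallyNonsingular, IsSingularSubset, D.card_quotient, not_exists, not_lt]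

/-! ### The trimmed system -/

/-- The name of the variable for the `p`-th derivative of `x_i`. -/
def trimName (i : Fin n) (p : ℕ) : TVar n :=
  if p = 0 then .inl i else .inr (i, p)

theorem trimName_inj {i i' : Fin n} {p p' : ℕ} :
    trimName i p = trimName i' p' ↔ i = i' ∧ p = p' := by
  unfold trimName
  split_ifs with h h' h' <;> simp
  all_goals omega

theorem exists_trimVar (G : SysGraph (Fin M) (Fin n)) (v : DVar (Fin n)) :
    (trimVar G v).shift = v.shift ∧ ∃ p, (trimVar G v).name = trimName v.name p := by
  unfold trimVar
  split_ifs with h h'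
  · exact ⟨rfl, v.der, by simp [trimName, show v.der ≠ 0 by omega]⟩
  · exact ⟨rfl, v.der - 1, by simp [trimName, show v.der - 1 ≠ 0 by omega]⟩
  · exact ⟨rfl, 0, rfl⟩

theorem inr_mem_trim_eqs {G : SysGraph (Fin M) (Fin n)} {i : Fin n} {p : ℕ} :
    Sum.inr (i, p) ∈ (trim G).eqs ↔ 1 ≤ p ∧ p < maxDer G i := by
  simp only [trim, List.mem_append, List.mem_map, List.mem_flatMap, List.mem_finRange,
    List.mem_range'_1]
  constructor
  · rintro (⟨_, _, h⟩ | ⟨i', -, p', hp, h⟩)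
    · cases h
    · obtain ⟨rfl, rfl⟩ := Prod.mk.inj (Sum.inr.inj h)
      omega
  · intro h
    exact .inr ⟨i, trivial, p, by omega, rfl⟩

theorem trim_eqs_nodup {G : SysGraph (Fin M) (Fin n)} (h : G.eqs.Nodup) :
    (trim G).eqs.Nodup := by
  simp only [trim]
  refine List.Nodup.append (h.map Sum.inl_injective) ?_ ?_
  · rw [List.nodup_flatMap]
    refine ⟨fun i _ => (List.nodup_range' ..).map fun p q hpq => ?_, ?_⟩
    · simpa using hpq
    · refine (List.nodup_finRange n).imp fun {a b} hab => ?_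
      intro x hx hx'
      simp only [List.mem_map] at hx hx'
      obtain ⟨p, -, rfl⟩ := hx
      obtain ⟨q, -, hq⟩ := hx'
      simp only [Sum.inr.injEq, Prod.mk.injEq] at hq
      exact hab hq.1.symm
  · intro x hx hx'
    simp only [List.mem_map, List.mem_flatMap] at hx hx'
    obtain ⟨j, -, rfl⟩ := hx
    obtain ⟨i, -, p, -, h⟩ := hx'
    cases h

/-- Some derivative of order above `p` appears at a nonnegative shift and bounds the supremum from
below. Hence the coupling equations keep both their variables in the differentiation graph. -/
theorem maxShift_nonneg {G : SysGraph (Fin M) (Fin n)} {i : Fin n} {p : ℕ}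
    (hp : p < maxDer G i) : 0 ≤ maxShift G i p := by
  unfold maxDer at hp
  obtain ⟨j, hj, hp⟩ := Finset.lt_sup_iff.1 hp
  obtain ⟨⟨i', q, k⟩, hv, hq⟩ := Finset.lt_sup_iff.1 hp
  simp only [Finset.mem_filter] at hv
  obtain ⟨hv, rfl, hk⟩ := hv
  refine hk.trans (le_csSup ?_ ⟨j, List.mem_toFinset.1 hj, q, hq.le, hv⟩)
  refine (((G.eqs.toFinset.biUnion G.vars).image DVar.shift).bddAbove).mono ?_
  rintro m ⟨a, ha, r, -, hm⟩
  simp only [Finset.coe_image, Finset.coe_biUnion, Set.mem_image, Set.mem_iUnion,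
    Finset.mem_coe, List.mem_toFinset]
  exact ⟨_, ⟨a, ha, hm⟩, rfl⟩

theorem exists_mem_tVars_dif {Q X : Type} [DecidableEq Q] [DecidableEq X] {G : SysGraph Q X}
    {j : Q} {v : DVar X} (hv : v ∈ G.vars j) (hk : 0 ≤ v.shift) :
    ∃ k, (v.name, k) ∈ tVars .dif G j :=
  ⟨v.der, mem_tVars_dif.2 ⟨v.der, v.shift, hk, rfl, hv⟩⟩

theorem exists_coupling_var {G : SysGraph (Fin M) (Fin n)} {i : Fin n} {p : ℕ} (hp : 1 ≤ p)
    (hp' : p < maxDer G i) {q : ℕ} (hq : q = p ∨ q = p - 1) :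
    ∃ k, (trimName i q, k) ∈ tVars .dif (trim G) (.inr (i, p)) := by
  have h0 := maxShift_nonneg hp'
  rcases hq with rfl | rfl
  · refine exists_mem_tVars_dif (v := ⟨trimName i q, 0, maxShift G i q⟩) ?_ h0
    simp [trim, trimName, show q ≠ 0 by omega]
  · refine exists_mem_tVars_dif (v := ⟨trimName i (p - 1), 1, maxShift G i p⟩) ?_ h0
    by_cases h1 : p = 1
    · simp [trim, trimName, h1]
    · simp [trim, trimName, h1, show p - 1 ≠ 0 by omega]

/-- If the equations can be matched with different variables at nonnegative shifts, then this
remains possible after trimmed linearization. -/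
theorem exists_trim_matching {G : SysGraph (Fin M) (Fin n)} (w : Fin M → DVar (Fin n))
    (hw : ∀ j, w j ∈ G.vars j ∧ 0 ≤ (w j).shift) (hinj : Function.Injective fun j => (w j).name) :
    ∃ π : TEq M n → TVar n,
      (∀ a ∈ (trim G).eqs, ∀ b ∈ (trim G).eqs, π a = π b → a = b) ∧
      ∀ j ∈ (trim G).eqs, ∃ k, (π j, k) ∈ tVars .dif (trim G) j := by
  choose hshift pos hpos using fun j => exists_trimVar G (w j)
  -- The position in the chain of `x_i` occupied by an original equation. With the default `0` for
  -- unoccupied chains, each coupling equation `p ≥ 1` simply takes position `p`.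
  let pos' : Fin n → ℕ := Function.extend (fun j => (w j).name) pos fun _ => 0
  have hpos' : ∀ j, pos' (w j).name = pos j := fun j => hinj.extend_apply pos _ j
  -- Coupling equation `p` contains positions `p - 1` and `p`. Those with `p` up to the occupied
  -- position move down and the others stay, so they are distinct and avoid it.
  let π : TEq M n → TVar n := Sum.elim (fun j => trimName (w j).name (pos j))
    fun ip => trimName ip.1 (if ip.2 ≤ pos' ip.1 then ip.2 - 1 else ip.2)
  refine ⟨π, ?_, ?_⟩
  · rintro (a | ⟨i, p⟩) ha (b | ⟨i', p'⟩) hb hab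
    · exact congrArg Sum.inl (hinj (trimName_inj.1 hab).1)
    · obtain ⟨h₁, h₂⟩ := trimName_inj.1 hab
      have hp := (inr_mem_trim_eqs.1 hb).1
      rw [← hpos' a, h₁] at h₂
      dsimp only at h₂
      split_ifs at h₂ <;> omega
    · obtain ⟨h₁, h₂⟩ := trimName_inj.1 hab
      have hp := (inr_mem_trim_eqs.1 ha).1
      rw [← hpos' b, ← h₁] at h₂
      dsimp only at h₂
      split_ifs at h₂ <;> omega
    · obtain ⟨h₁, h₂⟩ := trimName_inj.1 hab
      have hp := (inr_mem_trim_eqs.1 ha).1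
      have hp' := (inr_mem_trim_eqs.1 hb).1
      dsimp only at h₁ h₂
      subst h₁
      obtain rfl : p = p' := by split_ifs at h₂ <;> omega
      rfl
  · rintro (j | ⟨i, p⟩) hj
    · have := exists_mem_tVars_dif (G := trim G) (j := Sum.inl j) (v := trimVar G (w j))
        (Finset.mem_image_of_mem _ (hw j).1) (hshift j ▸ (hw j).2)
      rwa [hpos] at this
    · obtain ⟨hp, hp'⟩ := inr_mem_trim_eqs.1 hj
      refine exists_coupling_var hp hp' ?_
      dsimp only
      split_ifs
      exacts [.inr rfl, .inl rfl]

end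

end PantDDAE

theorem mainTheorem1 {M n : ℕ} (D : PantDDAE.DDAE M n)
    (ordS : PantDDAE.Enumeration (Fin n × ℤ))
    (ordD : PantDDAE.Enumeration (PantDDAE.TVar n × ℤ)) :
    D.PantelidesTerminates ordS ordD ↔
      PantDDAE.StructurallyNonsingular D.vars D.variables (PantDDAE.REqual (Fin n)) := by
  open PantDDAE in
  rw [D.structurallyNonsingular_iff]
  have hnd : D.graph.eqs.Nodup := List.nodup_finRange M
  have hmem : ∀ j, j ∈ D.graph.eqs := List.mem_finRange
  constructor
  · rintro ⟨G₁, -, h, -⟩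
    obtain ⟨-, hnames, v, hv, hinj⟩ := h.exists_matching hnd
    refine ⟨fun j => (v ⟨j, hmem j⟩).1, fun a b hab => congrArg Subtype.val (hinj hab), fun j => ?_⟩
    exact DDAE.mem_tVars_graph.1 ((hnames _ _).2 ⟨_, (hv ⟨j, hmem j⟩).2⟩)
  · rintro ⟨π, hπ, hmemπ⟩
    obtain ⟨G₁, h₁⟩ := exists_pantelides ordS (ty := .shift) hnd (fun a _ b _ hab => hπ hab)
      (fun j _ => DDAE.mem_tVars_graph.2 (hmemπ j))
    -- The names `π j` may occur in `D` only with a delay; the matching left by the shifting step is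
    -- at nonnegative shifts and so survives in the differentiation graph.
    obtain ⟨heqs, -, v, hv, hinj⟩ := h₁.exists_matching hnd
    have hw : ∀ j : {j // j ∈ D.graph.eqs}, ∃ w : DVar (Fin n), w ∈ G₁.vars j ∧ 0 ≤ w.shift ∧
        w.name = (v j).1 := by
      intro j
      obtain ⟨p, hp⟩ := mem_tVars_shift.1 (hv j).2
      exact ⟨_, hp, (hv j).1, rfl⟩
    choose w hw₁ hw₂ hw₃ using hw
    rw [← heqs] at hnd
    obtain ⟨ρ, hρ, hρmem⟩ := exists_trim_matching (G := G₁) (fun j => w ⟨j, hmem j⟩)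
      (fun j => ⟨hw₁ _, hw₂ _⟩) (fun a b hab => by
        simp only [hw₃] at hab
        exact congrArg Subtype.val (hinj hab))
    obtain ⟨G₂, h₂⟩ := exists_pantelides ordD (trim_eqs_nodup hnd) hρ hρmem
    exact ⟨G₁, G₂, h₁, h₂⟩
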